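/- Let $d\ge 3$ be an integer and let $T_d$ be the $d$-regular tree, that is, the infinite connected graph without cycles in which every vertex has exactly $d$ neighbours, with vertex set $V(T_d)$ and automorphism group $\mathrm{Aut}(T_d)$. Let $M$ be a finite set (with its discrete $\sigma$-algebra). Let $X=(X_v)_{v\in V(T_d)}$ be a factor of i.i.d. process on $M^{V(T_d)}$, that is, $X=F(Z)$, where $Z=(Z_v)_{v\in V(T_d)}$ consists of independent random labels uniformly distributed on $[0,1]$, and $F\colon[0,1]^{V(T_d)}\to M^{V(T_d)}$ is a measurable map that commutes with the natural actions of $\mathrm{Aut}(T_d)$ given by $(\gamma\cdot f)(s)=f(\gamma^{-1}s)$. Then for every integer $k\ge 0$ and all vertices $u,v$ of $T_d$ at graph distance $k$, $$I(X_u;X_v)\le \frac{|M|\,(k+1)^2}{(d-1)^k}.$$ Here $I(X_u;X_v)=H(X_u)+H(X_v)-H(X_u,X_v)$ is the mutual information, and $H$ denotes Shannon entropy, $H(Y)=\sum_y -\mathbb P(Y=y)\log\mathbb P(Y=y)$ with the natural logarithm (and $0\log 0=0$). -/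

import Mathlib

open MeasureTheory ProbabilityTheory

namespace TreeFactor

/-- The natural action of the automorphism group of a graph `G` on labelings of its vertices:
`(γ · f)(s) = f (γ⁻¹ s)`. -/
def act {V A : Type*} {G : SimpleGraph V} (γ : G ≃g G) (f : V → A) : V → A :=
  fun s => f (γ.symm s)

/-- `F : A^V → B^V` is an `Aut(G)`-factor: it is measurable with respect to the product
σ-algebras and commutes with the action of every automorphism of `G`. -/
structure IsFactor {V A B : Type*} [MeasurableSpace A] [MeasurableSpace B]
    (G : SimpleGraph V) (F : (V → A) → (V → B)) : Prop where
  measurable : Measurable F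
  equivariant : ∀ (γ : G ≃g G) (z : V → A), F (act γ z) = act γ (F z)

/-- The `Z v`, `v ∈ V`, are independent random variables on `(Ω, P)`, each of them uniformly
distributed on `[0,1]`. -/
structure IsIIDUniform {V Ω : Type*} [MeasurableSpace Ω] (P : Measure Ω)
    (Z : V → Ω → unitInterval) : Prop where
  measurable : ∀ v, Measurable (Z v)
  indep : iIndepFun Z P
  law : ∀ v, P.map (Z v) = (volume : Measure unitInterval)

/-- `X = (X v)_{v ∈ V}` is a factor of i.i.d. process: `X = F(Z)` for some `Aut(G)`-factor `F`
and some i.i.d. process `Z` of uniform `[0,1]` labels. -/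
def IsFactorOfIID {V Ω M : Type*} [MeasurableSpace Ω] [MeasurableSpace M]
    (G : SimpleGraph V) (P : Measure Ω) (X : V → Ω → M) : Prop :=
  ∃ (Z : V → Ω → unitInterval) (F : (V → unitInterval) → (V → M)),
    IsIIDUniform P Z ∧ IsFactor G F ∧ ∀ v ω, X v ω = F (fun w => Z w ω) v

/-- Shannon entropy `H(X) = ∑ -p log p` (natural logarithm) of a random variable with values in a
finite set. -/
noncomputable def entropy {Ω S : Type*} [MeasurableSpace Ω] [Fintype S]
    (P : Measure Ω) (X : Ω → S) : ℝ :=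
  ∑ x : S, Real.negMulLog (P.real (X ⁻¹' {x}))

/-- Mutual information `I(X;Y) = H(X) + H(Y) - H(X,Y)`. -/
noncomputable def mutualInfo {Ω S T : Type*} [MeasurableSpace Ω] [Fintype S] [Fintype T]
    (P : Measure Ω) (X : Ω → S) (Y : Ω → T) : ℝ :=
  entropy P X + entropy P Y - entropy P (fun ω => (X ω, Y ω))

end TreeFactor

/-! Put `r = (d-1)^(-1/2)`. Mutual information is bounded by the χ²-divergence of the joint law from
the product of its marginals (`negMulLog_sum_le_chiSquare`). Each row of that double sum, one for
each value of `X_u`, is at most `((k+1) r^k)^2`, and there are `|M|` rows. By duality a row bound is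
a correlation bound between a centred indicator at `u` and a suitable function of `X_v`
(`IsFactor.chiSquare_row_le`).

The correlation bound is `integral_mul_le_of_equivariant`. Expand both functions in Efron–Stein
components indexed by finite vertex sets `S`. Only components with the same `S` interact, and AM-GM
with a weight `w(S)` bounds the correlation by half of `∑ ‖f_S‖² w(S) + ∑ ‖g_S‖² w(S)⁻¹`. The weight
is `w(S) = φ_S(v) / φ_S(u)` with `φ_S(x) = ∑_{s ∈ S} r^dist(x,s)`, so that inverting it exchanges
`u` and `v`, and both sums can be treated alike.

A regular tree is distance-transitive (`exists_iso_of_dist_eq`), so by equivariance the first sum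
depends on `v` only through its distance from `u`, and `w(S)` may be averaged over the sphere of
radius `k` around `u`. That average is at most `(k+1) r^k` for every `S`
(`sphereSum_potentialRatio_le`): this is a computation for a single `s`, namely that the spherical
mean of `r^dist(·,s)` is at most `(k+1) r^k` times its value at the centre (`sphereSum_le`). -/

namespace TreeFactor

/-! ### Distance-transitivity of regular trees. -/

section Tree

variable {V : Type*} {G : SimpleGraph V}

theorem exists_adj_dist_succ (hG : G.Connected) {x z : V} (h : x ≠ z) :
    ∃ y, G.Adj x y ∧ G.dist x z = G.dist y z + 1 := by
  obtain ⟨p, hp⟩ := hG.exists_walk_length_eq_dist x z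
  cases p with
  | nil => exact absurd rfl h
  | @cons _ y _ hxy q =>
    refine ⟨y, hxy, le_antisymm ?_ ?_⟩
    · have := hG.dist_triangle (u := x) (v := y) (w := z)
      rw [SimpleGraph.dist_eq_one_iff_adj.2 hxy] at this
      omega
    · rw [← hp, SimpleGraph.Walk.length_cons]
      exact Nat.succ_le_succ (SimpleGraph.dist_le q)

theorem adj_dist_succ_unique (hG : G.IsTree) {x z y₁ y₂ : V}
    (h₁ : G.Adj x y₁) (h₂ : G.Adj x y₂)
    (e₁ : G.dist x z = G.dist y₁ z + 1) (e₂ : G.dist x z = G.dist y₂ z + 1) : y₁ = y₂ := by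
  have key : ∀ y, G.Adj x y → G.dist x z = G.dist y z + 1 →
      ∃ p : G.Walk x z, p.IsPath ∧ p.snd = y := by
    intro y hxy e
    obtain ⟨q, hq⟩ := hG.connected.exists_walk_length_eq_dist y z
    refine ⟨q.cons hxy, SimpleGraph.Walk.isPath_of_length_eq_dist _ ?_, by simp⟩
    rw [SimpleGraph.Walk.length_cons, hq, e]
  obtain ⟨p, hp, rfl⟩ := key y₁ h₁ e₁
  obtain ⟨q, hq, rfl⟩ := key y₂ h₂ e₂
  rw [(hG.existsUnique_path x z).unique hp hq]

theorem dist_adj_cases (hG : G.IsTree) {x y : V} (h : G.Adj x y) (z : V) :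
    G.dist x z = G.dist y z + 1 ∨ G.dist y z = G.dist x z + 1 := by
  have := hG.dist_eq_dist_add_one_of_adj z h
  rwa [G.dist_comm (u := z), G.dist_comm (u := z)] at this

/-- A set of vertices that contains every vertex lying between two of its members. -/
def GeodesicallyConvex (G : SimpleGraph V) (D : Set V) : Prop :=
  ∀ x ∈ D, ∀ y ∈ D, ∀ w, G.dist x w + G.dist w y = G.dist x y → w ∈ D

/-- Were `x` nearer to `z` than `y` is, it would lie between `y` and `z`, hence in `D`. -/
theorem GeodesicallyConvex.dist_of_adj (hG : G.IsTree) {D : Set V}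
    (hD : GeodesicallyConvex G D) {x y : V} (hy : y ∈ D) (hx : x ∉ D) (hxy : G.Adj x y)
    {z : V} (hz : z ∈ D) : G.dist x z = G.dist y z + 1 := by
  refine (dist_adj_cases hG hxy z).resolve_right fun h => hx (hD y hy z hz x ?_)
  rw [SimpleGraph.dist_eq_one_iff_adj.2 hxy.symm, h, add_comm]

/-- A geodesic from `x` to a point of `D` must leave `x` through `y`, because its first step is
unique; from `y` on it stays in `D`. -/
theorem GeodesicallyConvex.insert (hG : G.IsTree) {D : Set V}
    (hD : GeodesicallyConvex G D) {x y : V} (hy : y ∈ D) (hx : x ∉ D) (hxy : G.Adj x y) :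
    GeodesicallyConvex G (insert x D) := by
  have key : ∀ z ∈ D, ∀ w, G.dist x w + G.dist w z = G.dist x z → w ∈ Insert.insert x D := by
    intro z hz w hw
    by_cases hxw : x = w
    · exact Or.inl hxw.symm
    right
    obtain ⟨y', hxy', e⟩ := exists_adj_dist_succ hG.connected hxw
    have e' : G.dist x z = G.dist y' z + 1 := by
      have h1 := hG.connected.dist_triangle (u := y') (v := w) (w := z)
      have h2 := hG.connected.dist_triangle (u := x) (v := y') (w := z)
      rw [SimpleGraph.dist_eq_one_iff_adj.2 hxy'] at h2
      omega
    have hyz := hD.dist_of_adj hG hy hx hxy hz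
    obtain rfl := adj_dist_succ_unique hG hxy hxy' hyz e'
    exact hD y hy z hz w (by omega)
  rintro a (rfl | ha) b (rfl | hb) w hw
  · left
    rw [SimpleGraph.dist_self] at hw
    exact (hG.connected.dist_eq_zero_iff.1 (by omega)).symm
  · exact key b hb w hw
  · refine key a ha w ?_
    rw [G.dist_comm (u := b) (v := w), G.dist_comm (u := w) (v := a), G.dist_comm (u := b) (v := a),
      ← hw, add_comm]
  · exact Or.inr (hD a ha b hb w hw)

/-- A relation that is a distance preserving bijection between two geodesically convex sets. -/
structure PartialIsometry (G : SimpleGraph V) (ρ : Set (V × V)) : Prop where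
  dist_eq : ∀ p ∈ ρ, ∀ q ∈ ρ, G.dist p.1 q.1 = G.dist p.2 q.2
  convex_fst : GeodesicallyConvex G (Prod.fst '' ρ)
  convex_snd : GeodesicallyConvex G (Prod.snd '' ρ)

theorem PartialIsometry.swap {ρ : Set (V × V)} (h : PartialIsometry G ρ) :
    PartialIsometry G (Prod.swap '' ρ) := by
  refine ⟨?_, ?_, ?_⟩
  · rintro _ ⟨p, hp, rfl⟩ _ ⟨q, hq, rfl⟩
    exact (h.dist_eq p hp q hq).symm
  · rw [Set.image_image]; exact h.convex_snd
  · rw [Set.image_image]; exact h.convex_fst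

theorem partialIsometry_singleton (hG : G.IsTree) (u u' : V) :
    PartialIsometry G {(u, u')} := by
  have key : ∀ a : V, GeodesicallyConvex G {a} := by
    rintro a _ rfl _ rfl w hw
    rw [SimpleGraph.dist_self] at hw
    exact (hG.connected.dist_eq_zero_iff.1 (by omega)).symm
  refine ⟨?_, ?_, ?_⟩
  · rintro _ rfl _ rfl
    simp
  · rw [Set.image_singleton]; exact key _
  · rw [Set.image_singleton]; exact key _

theorem PartialIsometry.insert (hG : G.IsTree) {ρ : Set (V × V)} (h : PartialIsometry G ρ)
    {x x' y y' : V} (hy : (y, y') ∈ ρ) (hxy : G.Adj x y) (hxy' : G.Adj x' y')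
    (hx : x ∉ Prod.fst '' ρ) (hx' : x' ∉ Prod.snd '' ρ) :
    PartialIsometry G (insert (x, x') ρ) := by
  have hyD : y ∈ Prod.fst '' ρ := ⟨_, hy, rfl⟩
  have hyR : y' ∈ Prod.snd '' ρ := ⟨_, hy, rfl⟩
  have key : ∀ q ∈ ρ, G.dist x q.1 = G.dist x' q.2 := by
    intro q hq
    rw [h.convex_fst.dist_of_adj hG hyD hx hxy ⟨q, hq, rfl⟩,
      h.convex_snd.dist_of_adj hG hyR hx' hxy' ⟨q, hq, rfl⟩, h.dist_eq _ hy q hq]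
  refine ⟨?_, ?_, ?_⟩
  · rintro p (rfl | hp) q (rfl | hq)
    · simp
    · exact key q hq
    · rw [G.dist_comm, G.dist_comm (u := p.2)]; exact key p hp
    · exact h.dist_eq p hp q hq
  · rw [Set.image_insert_eq]; exact h.convex_fst.insert hG hyD hx hxy
  · rw [Set.image_insert_eq]; exact h.convex_snd.insert hG hyR hx' hxy'

/-- Matches the geodesic from `u` to `v` with the one from `u'` to `v'`. The distance bound is the
induction invariant that keeps the next pair of endpoints outside the domain and the range. -/
theorem exists_partialIsometry_of_dist_eq (hG : G.IsTree) (u u' : V) :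
    ∀ (k : ℕ) (v v' : V), G.dist u v = k → G.dist u' v' = k →
      ∃ ρ, PartialIsometry G ρ ∧ (u, u') ∈ ρ ∧ (v, v') ∈ ρ ∧ ∀ p ∈ ρ, G.dist u p.1 ≤ k
  | 0, v, v', hv, hv' => by
    obtain rfl := hG.connected.dist_eq_zero_iff.1 hv
    obtain rfl := hG.connected.dist_eq_zero_iff.1 hv'
    refine ⟨_, partialIsometry_singleton hG u u', rfl, rfl, ?_⟩
    rintro _ rfl
    simp
  | k + 1, v, v', hv, hv' => by
    have step : ∀ a b : V, G.dist a b = k + 1 → ∃ y, G.Adj b y ∧ G.dist a y = k := by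
      intro a b hab
      have hne : b ≠ a := by rintro rfl; simp at hab
      obtain ⟨y, hy, e⟩ := exists_adj_dist_succ hG.connected hne
      refine ⟨y, hy, ?_⟩
      rw [G.dist_comm] at hab ⊢
      omega
    obtain ⟨y, hvy, hy⟩ := step u v hv
    obtain ⟨y', hvy', hy'⟩ := step u' v' hv'
    obtain ⟨ρ, hρ, hu, hyρ, hle⟩ := exists_partialIsometry_of_dist_eq hG u u' k y y' hy hy'
    refine ⟨insert (v, v') ρ, hρ.insert hG hyρ hvy hvy' ?_ ?_, Or.inr hu, Or.inl rfl, ?_⟩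
    · rintro ⟨p, hp, rfl⟩
      have := hle p hp
      omega
    · rintro ⟨p, hp, rfl⟩
      have := hle p hp
      have := hρ.dist_eq _ hu p hp
      simp only at this
      omega
    · rintro p (rfl | hp)
      · exact hv.le
      · exact (hle p hp).trans (Nat.le_succ k)

theorem PartialIsometry.eq_of_fst_eq (hG : G.IsTree) {ρ : Set (V × V)}
    (h : PartialIsometry G ρ) {p q : V × V} (hp : p ∈ ρ) (hq : q ∈ ρ) (e : p.1 = q.1) :
    p = q := by
  refine Prod.ext e (hG.connected.dist_eq_zero_iff.1 ?_)
  rw [← h.dist_eq p hp q hq, e, SimpleGraph.dist_self]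

/-- Otherwise pulling back would inject the `d` neighbours of `y'` into the `d - 1` neighbours of
`y` other than `x`. -/
theorem PartialIsometry.exists_adj_notMem [G.LocallyFinite] (hG : G.IsTree) {d : ℕ}
    (hreg : G.IsRegularOfDegree d) {ρ : Set (V × V)} (h : PartialIsometry G ρ)
    {x y y' : V} (hy : (y, y') ∈ ρ) (hxy : G.Adj x y) (hx : x ∉ Prod.fst '' ρ) :
    ∃ x', G.Adj x' y' ∧ x' ∉ Prod.snd '' ρ := by
  classical
  by_contra! hcon
  choose! g hg hg' using hcon
  have hcard : (G.neighborFinset y').card ≤ ((G.neighborFinset y).erase x).card := by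
    refine Finset.card_le_card_of_injOn (fun z => (g z).1) ?_ ?_
    · intro z hz
      have hz' : G.Adj z y' := ((G.mem_neighborFinset y' z).1 hz).symm
      have h1 : G.dist (g z).1 y = 1 := by
        rw [h.dist_eq _ (hg z hz') _ hy, hg' z hz']
        exact SimpleGraph.dist_eq_one_iff_adj.2 hz'
      refine Finset.mem_coe.2 (Finset.mem_erase.2 ⟨?_, ?_⟩)
      · rintro rfl
        exact hx ⟨_, hg z hz', rfl⟩
      · rw [SimpleGraph.mem_neighborFinset]
        exact (SimpleGraph.dist_eq_one_iff_adj.1 h1).symm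
    · intro z hz w hw e
      have hz' : G.Adj z y' := ((G.mem_neighborFinset y' z).1 hz).symm
      have hw' : G.Adj w y' := ((G.mem_neighborFinset y' w).1 hw).symm
      rw [← hg' z hz', ← hg' w hw', h.eq_of_fst_eq hG (hg z hz') (hg w hw') e]
  have hlt := Finset.card_erase_lt_of_mem ((G.mem_neighborFinset y x).2 hxy.symm)
  rw [SimpleGraph.card_neighborFinset_eq_degree, hreg.degree_eq] at hcard
  rw [SimpleGraph.card_neighborFinset_eq_degree, hreg.degree_eq] at hlt
  omega

theorem eq_univ_of_adj_closed (hG : G.Connected) {D : Set V} {a : V} (ha : a ∈ D)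
    (h : ∀ y ∈ D, ∀ x, G.Adj x y → x ∈ D) : D = Set.univ := by
  refine Set.eq_univ_of_forall fun z => ?_
  obtain ⟨p⟩ := hG.preconnected a z
  induction p with
  | nil => exact ha
  | cons hxy q ih => exact ih (h _ ha _ hxy.symm)

theorem exists_partialIsometry_extend [G.LocallyFinite] (hG : G.IsTree) {d : ℕ}
    (hreg : G.IsRegularOfDegree d) {ρ : Set (V × V)} (h : PartialIsometry G ρ)
    (hne : ρ.Nonempty) (hD : Prod.fst '' ρ ≠ Set.univ) :
    ∃ p ∉ ρ, PartialIsometry G (insert p ρ) := by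
  obtain ⟨a, ha⟩ := hne
  have : ¬ ∀ y ∈ Prod.fst '' ρ, ∀ x, G.Adj x y → x ∈ Prod.fst '' ρ := fun hcl =>
    hD (eq_univ_of_adj_closed hG.connected ⟨a, ha, rfl⟩ hcl)
  push Not at this
  obtain ⟨_, ⟨⟨y, y'⟩, hy, rfl⟩, x, hxy, hx⟩ := this
  obtain ⟨x', hxy', hx'⟩ := h.exists_adj_notMem hG hreg hy hxy hx
  exact ⟨(x, x'), fun hmem => hx ⟨_, hmem, rfl⟩, h.insert hG hy hxy hxy' hx hx'⟩

theorem partialIsometry_sUnion {c : Set (Set (V × V))} (hc : IsChain (· ⊆ ·) c)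
    (h : ∀ ρ ∈ c, PartialIsometry G ρ) : PartialIsometry G (⋃₀ c) := by
  have key : ∀ p ∈ ⋃₀ c, ∀ q ∈ ⋃₀ c, ∃ ρ ∈ c, p ∈ ρ ∧ q ∈ ρ := by
    rintro p ⟨ρ, hρ, hp⟩ q ⟨σ, hσ, hq⟩
    rcases hc.total hρ hσ with hle | hle
    · exact ⟨σ, hσ, hle hp, hq⟩
    · exact ⟨ρ, hρ, hp, hle hq⟩
  refine ⟨?_, ?_, ?_⟩
  · intro p hp q hq
    obtain ⟨ρ, hρ, hp, hq⟩ := key p hp q hq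
    exact (h ρ hρ).dist_eq p hp q hq
  · rintro _ ⟨p, hp, rfl⟩ _ ⟨q, hq, rfl⟩ w hw
    obtain ⟨ρ, hρ, hp, hq⟩ := key p hp q hq
    exact Set.image_mono (Set.subset_sUnion_of_mem hρ)
      ((h ρ hρ).convex_fst _ ⟨p, hp, rfl⟩ _ ⟨q, hq, rfl⟩ w hw)
  · rintro _ ⟨p, hp, rfl⟩ _ ⟨q, hq, rfl⟩ w hw
    obtain ⟨ρ, hρ, hp, hq⟩ := key p hp q hq
    exact Set.image_mono (Set.subset_sUnion_of_mem hρ)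
      ((h ρ hρ).convex_snd _ ⟨p, hp, rfl⟩ _ ⟨q, hq, rfl⟩ w hw)

/-- A regular tree is distance-transitive. -/
theorem exists_iso_of_dist_eq [G.LocallyFinite] (hG : G.IsTree) {d : ℕ}
    (hreg : G.IsRegularOfDegree d) {u v u' v' : V} (h : G.dist u v = G.dist u' v') :
    ∃ γ : G ≃g G, γ u = u' ∧ γ v = v' := by
  obtain ⟨ρ₀, hρ₀, hu, hv, -⟩ := exists_partialIsometry_of_dist_eq hG u u' _ v v' h rfl
  obtain ⟨ρ, hle, hmax⟩ := zorn_subset_nonempty {ρ | PartialIsometry G ρ}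
    (fun c hc hchain _ => ⟨⋃₀ c, partialIsometry_sUnion hchain hc,
      fun s hs => Set.subset_sUnion_of_mem hs⟩) ρ₀ hρ₀
  have hρ : PartialIsometry G ρ := hmax.prop
  have hne : ρ.Nonempty := ⟨_, hle hu⟩
  have hfst : Prod.fst '' ρ = Set.univ := by
    by_contra hD
    obtain ⟨p, hp, hins⟩ := exists_partialIsometry_extend hG hreg hρ hne hD
    exact hp (hmax.le_of_ge hins (Set.subset_insert p ρ) (Set.mem_insert p ρ))
  -- The extension lemma only detects a missing point of the domain; applied to the inverse relation
  -- it detects a missing point of the range.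
  have hsnd : Prod.snd '' ρ = Set.univ := by
    by_contra hD
    obtain ⟨p, hp, hins⟩ := exists_partialIsometry_extend hG hreg hρ.swap (hne.image _)
      (by rw [Set.image_image]; exact hD)
    have hins' := hins.swap
    rw [Set.image_insert_eq, Set.image_image] at hins'
    simp only [Prod.swap_swap, Set.image_id'] at hins'
    exact hp ⟨p.swap, hmax.le_of_ge hins' (Set.subset_insert _ ρ) (Set.mem_insert _ ρ),
      Prod.swap_swap p⟩
  have hf : ∀ x, ∃ y, (x, y) ∈ ρ := by
    intro x
    obtain ⟨p, hp, rfl⟩ : x ∈ Prod.fst '' ρ := hfst ▸ Set.mem_univ x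
    exact ⟨p.2, hp⟩
  choose f hf using hf
  have hdist : ∀ x y, G.dist (f x) (f y) = G.dist x y := fun x y =>
    (hρ.dist_eq _ (hf x) _ (hf y)).symm
  have hval : ∀ p ∈ ρ, f p.1 = p.2 := fun p hp =>
    congrArg Prod.snd (hρ.eq_of_fst_eq hG (hf p.1) hp rfl)
  have hbij : Function.Bijective f := by
    refine ⟨fun x y e => hG.connected.dist_eq_zero_iff.1 ?_, fun y => ?_⟩
    · rw [← hdist, e, SimpleGraph.dist_self]
    · obtain ⟨p, hp, rfl⟩ : y ∈ Prod.snd '' ρ := hsnd ▸ Set.mem_univ y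
      exact ⟨p.1, hval p hp⟩
  refine ⟨⟨Equiv.ofBijective f hbij, ?_⟩, hval _ (hle hu), hval _ (hle hv)⟩
  intro a b
  rw [← SimpleGraph.dist_eq_one_iff_adj, ← SimpleGraph.dist_eq_one_iff_adj]
  exact iff_of_eq (congrArg (· = 1) (hdist a b))

end Tree

/-! ### Sums over spheres, organised by non-backtracking walks. -/

section SphericalSums

variable {V : Type*} (G : SimpleGraph V) [G.LocallyFinite]

open Classical in
/-- The sum of `h` over the ends of the non-backtracking walks of length `k` that start at `x` and
whose first step does not lead to `p`. -/
noncomputable def branchSum (h : V → ℝ) : ℕ → V → V → ℝ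
  | 0, _, x => h x
  | k + 1, p, x => ∑ y ∈ (G.neighborFinset x).erase p, branchSum h k x y

/-- The sum of `h` over the ends of the non-backtracking walks of length `k` that start at `u`. -/
noncomputable def sphereSum (h : V → ℝ) : ℕ → V → ℝ
  | 0, u => h u
  | k + 1, u => ∑ x ∈ G.neighborFinset u, branchSum G h k u x

/-- The number of vertices at distance `k` from a given vertex of the `d`-regular tree. -/
noncomputable def sphereCard (d : ℕ) : ℕ → ℝ
  | 0 => 1
  | k + 1 => d * ((d : ℝ) - 1) ^ k

theorem sphereCard_pos {d : ℕ} (hd : 3 ≤ d) (k : ℕ) : 0 < sphereCard d k := by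
  have : (3 : ℝ) ≤ d := by exact_mod_cast hd
  cases k with
  | zero => exact one_pos
  | succ k => exact mul_pos (by linarith) (pow_pos (by linarith) k)

variable {G}

theorem hasSum_branchSum {ι : Type*} {h : ι → V → ℝ} {H : V → ℝ}
    (hH : ∀ y, HasSum (fun i => h i y) (H y)) :
    ∀ (k : ℕ) (p x : V), HasSum (fun i => branchSum G (h i) k p x) (branchSum G H k p x)
  | 0, _, x => hH x
  | k + 1, _, x => hasSum_sum fun y _ => hasSum_branchSum hH k x y

theorem hasSum_sphereSum {ι : Type*} {h : ι → V → ℝ} {H : V → ℝ}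
    (hH : ∀ y, HasSum (fun i => h i y) (H y)) (k : ℕ) (u : V) :
    HasSum (fun i => sphereSum G (h i) k u) (sphereSum G H k u) := by
  cases k with
  | zero => exact hH u
  | succ k => exact hasSum_sum fun y _ => hasSum_branchSum hH k u y

theorem branchSum_mul_left (c : ℝ) (h : V → ℝ) :
    ∀ (k : ℕ) (p x : V), branchSum G (fun y => c * h y) k p x = c * branchSum G h k p x
  | 0, _, _ => rfl
  | k + 1, _, x => by
    simp only [branchSum, Finset.mul_sum, branchSum_mul_left c h k x]

theorem sphereSum_mul_left (c : ℝ) (h : V → ℝ) (k : ℕ) (u : V) :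
    sphereSum G (fun y => c * h y) k u = c * sphereSum G h k u := by
  cases k with
  | zero => rfl
  | succ k => simp only [sphereSum, Finset.mul_sum, branchSum_mul_left]

theorem branchSum_finset_sum {ι : Type*} (s : Finset ι) (h : ι → V → ℝ) :
    ∀ (k : ℕ) (p x : V),
      branchSum G (fun y => ∑ i ∈ s, h i y) k p x = ∑ i ∈ s, branchSum G (h i) k p x
  | 0, _, _ => rfl
  | k + 1, _, x => by
    simp only [branchSum, branchSum_finset_sum s h k x]
    exact Finset.sum_comm

theorem sphereSum_finset_sum {ι : Type*} (s : Finset ι) (h : ι → V → ℝ) (k : ℕ) (u : V) :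
    sphereSum G (fun y => ∑ i ∈ s, h i y) k u = ∑ i ∈ s, sphereSum G (h i) k u := by
  cases k with
  | zero => rfl
  | succ k =>
    simp only [sphereSum, branchSum_finset_sum]
    exact Finset.sum_comm

variable (hG : G.IsTree) {d : ℕ} (hreg : G.IsRegularOfDegree d)
include hG hreg

theorem branchSum_eq_of_const {h : V → ℝ} {c : ℝ} :
    ∀ (k : ℕ) (p x : V), G.Adj p x →
      (∀ y, G.dist x y = k → G.dist p y = k + 1 → h y = c) →
      branchSum G h k p x = ((d : ℝ) - 1) ^ k * c
  | 0, p, x, hpx, hc => by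
    rw [branchSum, pow_zero, one_mul]
    exact hc x (by simp) (by simpa using hpx)
  | k + 1, p, x, hpx, hc => by
    classical
    have hmem : p ∈ G.neighborFinset x := (G.mem_neighborFinset x p).2 hpx.symm
    have hterm : ∀ y ∈ (G.neighborFinset x).erase p,
        branchSum G h k x y = ((d : ℝ) - 1) ^ k * c := by
      intro y hy
      rw [Finset.mem_erase, SimpleGraph.mem_neighborFinset] at hy
      refine branchSum_eq_of_const k x y hy.2 fun z hyz hxz => hc z hxz ?_
      -- If `z` were nearer to `p` than to `x`, the step from `x` towards `z` would be `p`, which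
      -- has been erased.
      rcases dist_adj_cases hG hpx z with h1 | h1
      · omega
      · exact absurd (adj_dist_succ_unique hG hpx.symm hy.2 h1 (by omega)) (Ne.symm hy.1)
    have hd : 1 ≤ d := by
      rw [← hreg.degree_eq x, ← SimpleGraph.card_neighborFinset_eq_degree]
      exact Finset.card_pos.2 ⟨p, hmem⟩
    rw [branchSum, Finset.sum_congr (by congr) hterm, Finset.sum_const, Finset.card_erase_of_mem hmem,
      SimpleGraph.card_neighborFinset_eq_degree, hreg.degree_eq, nsmul_eq_mul, Nat.cast_sub hd,
      Nat.cast_one, pow_succ']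
    ring

theorem sphereSum_eq_of_const {h : V → ℝ} {c : ℝ} {k : ℕ} {u : V}
    (hc : ∀ y, G.dist u y = k → h y = c) : sphereSum G h k u = sphereCard d k * c := by
  cases k with
  | zero =>
    rw [sphereSum, sphereCard, one_mul]
    exact hc u (by simp)
  | succ k =>
    have hterm : ∀ x ∈ G.neighborFinset u, branchSum G h k u x = ((d : ℝ) - 1) ^ k * c := by
      intro x hx
      rw [SimpleGraph.mem_neighborFinset] at hx
      exact branchSum_eq_of_const hG hreg k u x hx fun y _ hy => hc y hy
    rw [sphereSum, Finset.sum_congr rfl hterm, Finset.sum_const,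
      SimpleGraph.card_neighborFinset_eq_degree, hreg.degree_eq, nsmul_eq_mul, sphereCard, mul_assoc]

variable {t r : ℝ} (ht : 0 < t) (htr : t * r = 1) (htd : t ^ 2 = (d : ℝ) - 1) (s : V)
include ht htr htd

omit hG hreg htd in
theorem inv_weight_pos : 0 < r := by
  by_contra! h
  nlinarith

omit ht in
-- A walk that has begun to recede from `s` recedes for ever. Each step multiplies the number of
-- walks by `t ^ 2` and the summand by `r`, a net factor `t`.
theorem branchSum_le_of_far :
    ∀ (k : ℕ) (p x : V), G.Adj p x → G.dist x s = G.dist p s + 1 →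
      branchSum G (fun y => r ^ G.dist y s) k p x ≤ t ^ k * r ^ G.dist x s
  | 0, p, x, hpx, hfar => by simp [branchSum]
  | k + 1, p, x, hpx, hfar => by
    classical
    have hmem : p ∈ G.neighborFinset x := (G.mem_neighborFinset x p).2 hpx.symm
    have hterm : ∀ y ∈ (G.neighborFinset x).erase p,
        branchSum G (fun y => r ^ G.dist y s) k x y ≤ t ^ k * r ^ (G.dist x s + 1) := by
      intro y hy
      rw [Finset.mem_erase, SimpleGraph.mem_neighborFinset] at hy
      have e : G.dist y s = G.dist x s + 1 := by
        refine (dist_adj_cases hG hy.2 s).resolve_left fun h1 => ?_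
        exact hy.1 (adj_dist_succ_unique hG hy.2 hpx.symm h1 hfar)
      rw [← e]
      exact branchSum_le_of_far k x y hy.2 e
    have hd : 1 ≤ d := by
      rw [← hreg.degree_eq x, ← SimpleGraph.card_neighborFinset_eq_degree]
      exact Finset.card_pos.2 ⟨p, hmem⟩
    have hsum := Finset.sum_le_sum hterm
    rw [Finset.sum_const, Finset.card_erase_of_mem hmem,
      SimpleGraph.card_neighborFinset_eq_degree, hreg.degree_eq, nsmul_eq_mul, Nat.cast_sub hd,
      Nat.cast_one, ← htd] at hsum
    rw [branchSum]
    refine (le_of_eq (by congr)).trans (hsum.trans (le_of_eq ?_))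
    rw [pow_succ r, pow_succ t]
    linear_combination (t ^ k * t * r ^ G.dist x s) * htr

/-- At most one neighbour of `x` leads towards `s`; it carries the induction hypothesis, while all
receding branches together contribute one further unit `t ^ (k + 1) * r ^ dist x s`. Hence the
linear factor. -/
theorem branchSum_le :
    ∀ (k : ℕ) (p x : V), G.Adj p x →
      branchSum G (fun y => r ^ G.dist y s) k p x ≤ (k + 1) * (t ^ k * r ^ G.dist x s)
  | 0, p, x, hpx => by simp [branchSum]
  | k + 1, p, x, hpx => by
    classical
    have hr := inv_weight_pos ht htr
    have hmem : p ∈ G.neighborFinset x := (G.mem_neighborFinset x p).2 hpx.symm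
    have hd : 1 ≤ d := by
      rw [← hreg.degree_eq x, ← SimpleGraph.card_neighborFinset_eq_degree]
      exact Finset.card_pos.2 ⟨p, hmem⟩
    have hcard : (((G.neighborFinset x).erase p).card : ℝ) = t ^ 2 := by
      rw [Finset.card_erase_of_mem hmem, SimpleGraph.card_neighborFinset_eq_degree,
        hreg.degree_eq, Nat.cast_sub hd, Nat.cast_one, ← htd]
    set C : ℝ := t ^ k * r ^ (G.dist x s + 1) with hC
    set B : ℝ := (k + 1) * (t ^ (k + 1) * r ^ G.dist x s) with hB
    have hC0 : 0 ≤ C := by positivity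
    have hB0 : 0 ≤ B := by positivity
    obtain ⟨y₀, hy₀⟩ : ∃ y₀, ∀ y, G.Adj x y → G.dist x s = G.dist y s + 1 → y = y₀ := by
      by_cases h : ∃ y, G.Adj x y ∧ G.dist x s = G.dist y s + 1
      · obtain ⟨y₀, h1, h2⟩ := h
        exact ⟨y₀, fun y h3 h4 => adj_dist_succ_unique hG h3 h1 h4 h2⟩
      -- No neighbour approaches `s`, so `y₀` is a dummy.
      · exact ⟨x, fun y h3 h4 => absurd ⟨y, h3, h4⟩ h⟩
    have hterm : ∀ y ∈ (G.neighborFinset x).erase p,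
        branchSum G (fun y => r ^ G.dist y s) k x y ≤ (if y = y₀ then B else 0) + C := by
      intro y hy
      rw [Finset.mem_erase, SimpleGraph.mem_neighborFinset] at hy
      rcases dist_adj_cases hG hy.2 s with h1 | h1
      · rw [if_pos (hy₀ y hy.2 h1)]
        refine (branchSum_le k x y hy.2).trans ?_
        have : B = (k + 1) * (t ^ k * r ^ G.dist y s) := by
          rw [hB, h1, pow_succ, pow_succ]
          linear_combination ((k + 1) * t ^ k * r ^ G.dist y s) * htr
        linarith
      · have h2 := branchSum_le_of_far hG hreg htr htd s k x y hy.2 h1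
        rw [h1] at h2
        refine h2.trans (le_add_of_nonneg_left ?_)
        split_ifs
        exacts [hB0, le_rfl]
    have hsum := Finset.sum_le_sum hterm
    rw [Finset.sum_add_distrib, Finset.sum_const, nsmul_eq_mul, hcard,
      Finset.sum_ite_eq'] at hsum
    have hle : (if y₀ ∈ (G.neighborFinset x).erase p then B else 0) ≤ B := by
      split_ifs
      exacts [le_rfl, hB0]
    rw [branchSum]
    have hCt : t ^ 2 * C = t ^ (k + 1) * r ^ G.dist x s := by
      rw [hC, pow_succ r, pow_succ t]
      linear_combination (t ^ k * t * r ^ G.dist x s) * htr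
    have hfin : B + t ^ 2 * C = ((k + 1 : ℕ) + 1) * (t ^ (k + 1) * r ^ G.dist x s) := by
      rw [hCt, hB]
      push_cast
      ring
    rw [← hfin]
    refine le_trans (le_of_eq ?_) (hsum.trans (add_le_add_left hle _))
    congr

theorem sphereSum_le (k : ℕ) (u : V) :
    sphereSum G (fun y => r ^ G.dist y s) k u ≤
      sphereCard d k * ((k + 1) * r ^ k) * r ^ G.dist u s := by
  cases k with
  | zero => simp [sphereSum, sphereCard]
  | succ k =>
    classical
    have hr := inv_weight_pos ht htr
    set C : ℝ := t ^ k * r ^ (G.dist u s + 1) with hC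
    set B : ℝ := (k + 1) * (t ^ (k + 1) * r ^ G.dist u s) with hB
    have hC0 : 0 ≤ C := by positivity
    have hB0 : 0 ≤ B := by positivity
    obtain ⟨y₀, hy₀⟩ : ∃ y₀, ∀ y, G.Adj u y → G.dist u s = G.dist y s + 1 → y = y₀ := by
      by_cases h : ∃ y, G.Adj u y ∧ G.dist u s = G.dist y s + 1
      · obtain ⟨y₀, h1, h2⟩ := h
        exact ⟨y₀, fun y h3 h4 => adj_dist_succ_unique hG h3 h1 h4 h2⟩
      · exact ⟨u, fun y h3 h4 => absurd ⟨y, h3, h4⟩ h⟩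
    have hterm : ∀ y ∈ G.neighborFinset u,
        branchSum G (fun y => r ^ G.dist y s) k u y ≤ (if y = y₀ then B else 0) + C := by
      intro y hy
      rw [SimpleGraph.mem_neighborFinset] at hy
      rcases dist_adj_cases hG hy s with h1 | h1
      · rw [if_pos (hy₀ y hy h1)]
        refine (branchSum_le hG hreg ht htr htd s k u y hy).trans ?_
        have : B = (k + 1) * (t ^ k * r ^ G.dist y s) := by
          rw [hB, h1, pow_succ, pow_succ]
          linear_combination ((k + 1) * t ^ k * r ^ G.dist y s) * htr
        linarith
      · have h2 := branchSum_le_of_far hG hreg htr htd s k u y hy h1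
        rw [h1] at h2
        refine h2.trans (le_add_of_nonneg_left ?_)
        split_ifs
        exacts [hB0, le_rfl]
    have hsum := Finset.sum_le_sum hterm
    rw [Finset.sum_add_distrib, Finset.sum_const, nsmul_eq_mul,
      SimpleGraph.card_neighborFinset_eq_degree, hreg.degree_eq, Finset.sum_ite_eq'] at hsum
    have hle : (if y₀ ∈ G.neighborFinset u then B else 0) ≤ B := by
      split_ifs
      exacts [le_rfl, hB0]
    rw [sphereSum]
    refine (hsum.trans (add_le_add_left hle _)).trans ?_
    have hd : (d : ℝ) = t ^ 2 + 1 := by rw [htd]; ring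
    have htrk : t ^ k * r ^ k = 1 := by rw [← mul_pow, htr, one_pow]
    -- The claimed bound exceeds the estimate `B + d * C` by exactly `(k + 1) * C`, which is
    -- nonnegative.
    have hmain : sphereCard d (k + 1) * (((k + 1 : ℕ) + 1) * r ^ (k + 1)) * r ^ G.dist u s =
        B + d * C + (k + 1) * C := by
      rw [sphereCard, ← htd, hB, hC, hd]
      have e : (t ^ 2) ^ k * r ^ (k + 1) = t ^ k * r := by
        rw [← pow_mul, mul_comm 2 k, pow_mul, pow_two, pow_succ r, mul_assoc, ← mul_assoc (t ^ k) _ r,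
          htrk, one_mul]
      push_cast
      rw [pow_succ r (G.dist u s), pow_succ t k]
      linear_combination ((t ^ 2 + 1) * (k + 2) * r ^ G.dist u s) * e +
        ((k + 1) * t ^ k * t * r ^ G.dist u s) * htr
    rw [hmain]
    have : 0 ≤ (k + 1 : ℝ) * C := by positivity
    linarith

end SphericalSums

/-! ### The weights on finite vertex sets. -/

section Weights

variable {V : Type*} {G : SimpleGraph V}

theorem dist_iso (γ : G ≃g G) (hG : G.Connected) (x y : V) :
    G.dist (γ x) (γ y) = G.dist x y := by
  have key : ∀ (γ : G ≃g G) (x y : V), G.dist (γ x) (γ y) ≤ G.dist x y := by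
    intro γ x y
    obtain ⟨p, hp⟩ := hG.exists_walk_length_eq_dist x y
    rw [← hp, ← SimpleGraph.Walk.length_map γ.toHom p]
    exact SimpleGraph.dist_le _
  refine le_antisymm (key γ x y) ?_
  simpa using key γ.symm (γ x) (γ y)

/-- The ratio of the potentials `∑ s ∈ S, r ^ dist · s` at `v` and at `u`. -/
noncomputable def potentialRatio (G : SimpleGraph V) (r : ℝ) (u v : V) (S : Finset V) : ℝ :=
  (∑ s ∈ S, r ^ G.dist v s) / ∑ s ∈ S, r ^ G.dist u s

/-- True also for `S = ∅`, where both sides are `0`. -/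
theorem potentialRatio_inv (r : ℝ) (u v : V) (S : Finset V) :
    (potentialRatio G r u v S)⁻¹ = potentialRatio G r v u S :=
  inv_div _ _

theorem potential_pos {r : ℝ} (hr : 0 < r) (u : V) {S : Finset V} (hS : S.Nonempty) :
    0 < ∑ s ∈ S, r ^ G.dist u s :=
  Finset.sum_pos (fun _ _ => pow_pos hr _) hS

theorem potentialRatio_pos {r : ℝ} (hr : 0 < r) (u v : V) {S : Finset V} (hS : S.Nonempty) :
    0 < potentialRatio G r u v S :=
  div_pos (potential_pos hr v hS) (potential_pos hr u hS)

theorem potentialRatio_nonneg {r : ℝ} (hr : 0 < r) (u v : V) (S : Finset V) :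
    0 ≤ potentialRatio G r u v S :=
  div_nonneg (Finset.sum_nonneg fun _ _ => (pow_pos hr _).le)
    (Finset.sum_nonneg fun _ _ => (pow_pos hr _).le)

theorem potentialRatio_map (hG : G.Connected) (γ : G ≃g G) (r : ℝ) (u v : V) (S : Finset V) :
    potentialRatio G r (γ u) (γ v) (S.map γ.toEquiv.toEmbedding) = potentialRatio G r u v S := by
  simp only [potentialRatio, Finset.sum_map]
  congr 1 <;>
  exact Finset.sum_congr rfl fun s _ => congrArg (r ^ ·) (dist_iso γ hG _ s)

/-- A crude bound from the triangle inequality, uniform in `S`; it serves only for summability. -/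
theorem potentialRatio_le (hG : G.Connected) {t r : ℝ} (ht : 1 ≤ t) (htr : t * r = 1)
    (u v : V) (S : Finset V) : potentialRatio G r u v S ≤ t ^ G.dist u v := by
  have ht0 : 0 < t := by linarith
  have hr := inv_weight_pos ht0 htr
  have hr1 : r ≤ 1 := by nlinarith
  refine div_le_of_le_mul₀ (Finset.sum_nonneg fun _ _ => (pow_pos hr _).le)
    (pow_nonneg ht0.le _) ?_
  rw [Finset.mul_sum]
  refine Finset.sum_le_sum fun s _ => ?_
  calc r ^ G.dist v s = t ^ G.dist u v * r ^ (G.dist u v + G.dist v s) := by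
        rw [pow_add, ← mul_assoc, ← mul_pow, htr, one_pow, one_mul]
    _ ≤ t ^ G.dist u v * r ^ G.dist u s :=
        mul_le_mul_of_nonneg_left (pow_le_pow_of_le_one hr.le hr1 hG.dist_triangle)
          (pow_nonneg ht0.le _)

/-- The denominator does not depend on `v`, so the bound for a single `s` can be summed over `S`. -/
theorem sphereSum_potentialRatio_le [G.LocallyFinite] (hG : G.IsTree) {d : ℕ} (hd : 3 ≤ d)
    (hreg : G.IsRegularOfDegree d) {t r : ℝ} (ht : 0 < t) (htr : t * r = 1)
    (htd : t ^ 2 = (d : ℝ) - 1) (k : ℕ) (u : V) (S : Finset V) :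
    sphereSum G (fun v => potentialRatio G r u v S) k u ≤
      sphereCard d k * ((k + 1) * r ^ k) := by
  have hr := inv_weight_pos ht htr
  have hrhs : 0 ≤ sphereCard d k * ((k + 1) * r ^ k) := by
    have := (sphereCard_pos hd k).le
    positivity
  simp only [potentialRatio, div_eq_inv_mul]
  rw [sphereSum_mul_left, sphereSum_finset_sum, ← div_eq_inv_mul]
  refine div_le_of_le_mul₀ (Finset.sum_nonneg fun _ _ => (pow_pos hr _).le) hrhs ?_
  rw [Finset.mul_sum]
  exact Finset.sum_le_sum fun s _ => sphereSum_le hG hreg ht htr htd s k u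

end Weights

/-! ### Efron–Stein decomposition over an i.i.d. product measure. -/

section EfronStein

/-- Bounded measurable real functions. -/
structure BoundedMeasurable {α : Type*} [MeasurableSpace α] (f : α → ℝ) : Prop where
  measurable : Measurable f
  bound : ∃ C, ∀ z, |f z| ≤ C

namespace BoundedMeasurable

variable {α β : Type*} [MeasurableSpace α] [MeasurableSpace β] {f g : α → ℝ}

theorem integrable (hf : BoundedMeasurable f) (μ : Measure α) [IsFiniteMeasure μ] :
    Integrable f μ := by
  obtain ⟨C, hC⟩ := hf.bound
  exact Integrable.of_bound hf.measurable.aestronglyMeasurable C (ae_of_all _ hC)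

theorem const (c : ℝ) : BoundedMeasurable (fun _ : α => c) :=
  ⟨measurable_const, |c|, fun _ => le_rfl⟩

theorem add (hf : BoundedMeasurable f) (hg : BoundedMeasurable g) :
    BoundedMeasurable (fun z => f z + g z) := by
  obtain ⟨C, hC⟩ := hf.bound
  obtain ⟨D, hD⟩ := hg.bound
  exact ⟨hf.measurable.add hg.measurable, C + D, fun z =>
    (abs_add_le _ _).trans (add_le_add (hC z) (hD z))⟩

theorem mul (hf : BoundedMeasurable f) (hg : BoundedMeasurable g) :
    BoundedMeasurable (fun z => f z * g z) := by
  obtain ⟨C, hC⟩ := hf.bound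
  obtain ⟨D, hD⟩ := hg.bound
  refine ⟨hf.measurable.mul hg.measurable, C * D, fun z => ?_⟩
  rw [abs_mul]
  exact mul_le_mul (hC z) (hD z) (abs_nonneg _) ((abs_nonneg _).trans (hC z))

theorem sub (hf : BoundedMeasurable f) (hg : BoundedMeasurable g) :
    BoundedMeasurable (fun z => f z - g z) := by
  have := hf.add ((const (-1)).mul hg)
  simpa [sub_eq_add_neg] using this

theorem abs (hf : BoundedMeasurable f) : BoundedMeasurable (fun z => |f z|) := by
  obtain ⟨C, hC⟩ := hf.bound
  exact ⟨hf.measurable.abs, C, fun z => (abs_abs (f z)).le.trans (hC z)⟩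

theorem comp (hf : BoundedMeasurable f) {φ : β → α} (hφ : Measurable φ) :
    BoundedMeasurable (fun z => f (φ z)) := by
  obtain ⟨C, hC⟩ := hf.bound
  exact ⟨hf.measurable.comp hφ, C, fun z => hC _⟩

theorem finset_sum {ι : Type*} (s : Finset ι) {F : ι → α → ℝ}
    (hF : ∀ i, BoundedMeasurable (F i)) : BoundedMeasurable (fun z => ∑ i ∈ s, F i z) := by
  classical
  induction s using Finset.induction_on with
  | empty => simpa using const (α := α) 0
  | insert a s ha ih =>
    simp only [Finset.sum_insert ha]
    exact (hF a).add ih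

theorem indicator {B : Set α} (hB : MeasurableSet B) :
    BoundedMeasurable (B.indicator fun _ => (1 : ℝ)) := by
  refine ⟨measurable_const.indicator hB, 1, fun z => ?_⟩
  by_cases hz : z ∈ B <;> simp [hz]

theorem integral_right {f : α × β → ℝ} (hf : BoundedMeasurable f) (μ : Measure β)
    [IsProbabilityMeasure μ] : BoundedMeasurable (fun x => ∫ y, f (x, y) ∂μ) := by
  obtain ⟨C, hC⟩ := hf.bound
  refine ⟨(StronglyMeasurable.integral_prod_right (f := fun x y => f (x, y))
    hf.measurable.stronglyMeasurable).measurable, C, fun x => ?_⟩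
  simpa using norm_integral_le_of_norm_le_const (μ := μ) (f := fun y => f (x, y))
    (ae_of_all _ fun y => hC (x, y))

end BoundedMeasurable

variable {V E : Type*}

open Classical in
/-- The labeling that agrees with `z` on `A` and with `z'` off `A`. -/
noncomputable def merge (A : Finset V) (z z' : V → E) : V → E :=
  fun v => if v ∈ A then z v else z' v

theorem merge_merge_left (A : Finset V) (x y z : V → E) :
    merge A (merge A x y) z = merge A x z := by
  ext v; by_cases hv : v ∈ A <;> simp [merge, hv]

variable [MeasurableSpace E] (ν : Measure E) [IsProbabilityMeasure ν]

theorem measurable_merge (A : Finset V) :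
    Measurable (fun p : (V → E) × (V → E) => merge A p.1 p.2) := by
  refine measurable_pi_lambda _ fun v => ?_
  by_cases hv : v ∈ A
  · simp only [merge, hv, if_true]
    fun_prop
  · simp only [merge, hv, if_false]
    fun_prop

/-- Resampling the labels off `A` preserves the product measure. -/
theorem measurePreserving_merge (A : Finset V) :
    MeasurePreserving (fun p : (V → E) × (V → E) => merge A p.1 p.2)
      ((Measure.infinitePi fun _ : V => ν).prod (Measure.infinitePi fun _ : V => ν))
      (Measure.infinitePi fun _ : V => ν) := by
  classical
  refine ⟨measurable_merge A, Measure.eq_infinitePi _ fun s t ht => ?_⟩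
  rw [Measure.map_apply (measurable_merge A)
    (MeasurableSet.pi s.countable_toSet fun i _ => ht i)]
  have hpre : (fun p : (V → E) × (V → E) => merge A p.1 p.2) ⁻¹' (Set.pi (s : Set V) t) =
      (Set.pi ((s.filter (· ∈ A) : Finset V) : Set V) t) ×ˢ
        (Set.pi ((s.filter (· ∉ A) : Finset V) : Set V) t) := by
    ext ⟨x, y⟩
    simp only [Set.mem_preimage, Set.mem_pi, Set.mem_prod, Finset.coe_filter, Set.mem_ofPred_eq,
      Finset.mem_coe, merge]
    constructor
    · intro h
      exact ⟨fun i hi => by simpa [hi.2] using h i hi.1, fun i hi => by simpa [hi.2] using h i hi.1⟩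
    · rintro ⟨h1, h2⟩ i hi
      by_cases hA : i ∈ A
      · simpa [hA] using h1 i ⟨hi, hA⟩
      · simpa [hA] using h2 i ⟨hi, hA⟩
  rw [hpre, Measure.prod_prod, Measure.infinitePi_pi _ fun i _ => ht i,
    Measure.infinitePi_pi _ fun i _ => ht i, Finset.prod_filter_mul_prod_filter_not]

/-- The conditional expectation of `f` given the labels on `A`. -/
noncomputable def avg (A : Finset V) (f : (V → E) → ℝ) (z : V → E) : ℝ :=
  ∫ z', f (merge A z z') ∂(Measure.infinitePi fun _ : V => ν)

variable {f g : (V → E) → ℝ}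

theorem BoundedMeasurable.comp_merge (hf : BoundedMeasurable f) (A : Finset V) :
    BoundedMeasurable (fun p : (V → E) × (V → E) => f (merge A p.1 p.2)) :=
  hf.comp (measurable_merge A)

theorem BoundedMeasurable.comp_merge_right (hf : BoundedMeasurable f) (A : Finset V)
    (z : V → E) : BoundedMeasurable (fun z' => f (merge A z z')) :=
  hf.comp ((measurable_merge A).comp measurable_prodMk_left)

theorem BoundedMeasurable.avg (hf : BoundedMeasurable f) (A : Finset V) :
    BoundedMeasurable (avg ν A f) :=
  (hf.comp_merge A).integral_right _

theorem integral_merge (hf : BoundedMeasurable f) (A : Finset V) :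
    ∫ x, ∫ y, f (merge A x y) ∂(Measure.infinitePi fun _ : V => ν)
      ∂(Measure.infinitePi fun _ : V => ν) = ∫ z, f z ∂(Measure.infinitePi fun _ : V => ν) := by
  have hmp := measurePreserving_merge (V := V) ν A
  conv_rhs => rw [← hmp.map_eq, integral_map hmp.measurable.aemeasurable
    hf.measurable.aestronglyMeasurable]
  exact (integral_prod _ ((hf.comp_merge A).integrable
    ((Measure.infinitePi fun _ : V => ν).prod (Measure.infinitePi fun _ : V => ν)))).symm

theorem integral_avg (hf : BoundedMeasurable f) (A : Finset V) :
    ∫ z, avg ν A f z ∂(Measure.infinitePi fun _ : V => ν) =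
      ∫ z, f z ∂(Measure.infinitePi fun _ : V => ν) :=
  integral_merge ν hf A

open Classical in
theorem avg_avg (hf : BoundedMeasurable f) (A B : Finset V) (z : V → E) :
    avg ν A (avg ν B f) z = avg ν (A ∩ B) f z := by
  -- The two resamplings enter only through `merge B z' z''`, which again has the product law.
  have e : ∀ z' z'' : V → E,
      merge B (merge A z z') z'' = merge (A ∩ B) z (merge B z' z'') := by
    intro z' z''
    ext v
    by_cases hA : v ∈ A <;> by_cases hB : v ∈ B <;> simp [merge, hA, hB]
  simp only [avg, e]
  exact integral_merge ν (hf.comp_merge_right (A ∩ B) z) B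

theorem integral_avg_mul (hf : BoundedMeasurable f) (hg : BoundedMeasurable g) (A : Finset V) :
    ∫ z, avg ν A f z * g z ∂(Measure.infinitePi fun _ : V => ν) =
      ∫ z, avg ν A f z * avg ν A g z ∂(Measure.infinitePi fun _ : V => ν) := by
  rw [← integral_merge ν ((hf.avg ν A).mul hg) A]
  have e : ∀ x y : V → E, avg ν A f (merge A x y) = avg ν A f x := fun x y => by
    simp only [avg, merge_merge_left]
  simp only [e, integral_const_mul]
  rfl

theorem avg_finset_sum {ι : Type*} (s : Finset ι) {F : ι → (V → E) → ℝ} (c : ι → ℝ)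
    (hF : ∀ i, BoundedMeasurable (F i)) (A : Finset V) (z : V → E) :
    avg ν A (fun z => ∑ i ∈ s, c i * F i z) z = ∑ i ∈ s, c i * avg ν A (F i) z := by
  simp only [avg]
  rw [integral_finsetSum _ fun i _ =>
    ((BoundedMeasurable.const (c i)).mul ((hF i).comp_merge_right A z)).integrable _]
  simp only [integral_const_mul]

/-- The component of `f` in the Efron–Stein decomposition that depends exactly on the labels
on `S`. -/
noncomputable def component (S : Finset V) (f : (V → E) → ℝ) (z : V → E) : ℝ :=
  ∑ T ∈ S.powerset, (-1) ^ (S.card + T.card) * avg ν T f z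

theorem BoundedMeasurable.component (hf : BoundedMeasurable f) (S : Finset V) :
    BoundedMeasurable (component ν S f) :=
  .finset_sum _ fun T => (BoundedMeasurable.const _).mul (hf.avg ν T)

omit [MeasurableSpace E] in
-- Möbius inversion on the Boolean lattice.
theorem sum_powerset_moebius (A : Finset V) (g : Finset V → ℝ) :
    ∑ S ∈ A.powerset, ∑ T ∈ S.powerset, (-1) ^ (S.card + T.card) * g T = g A := by
  classical
  induction A using Finset.induction_on generalizing g with
  | empty => simp
  | insert a B ha ih =>
    rw [Finset.sum_powerset_insert ha, ih]
    have hstep : ∀ S ∈ B.powerset,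
        ∑ T ∈ (insert a S).powerset, (-1 : ℝ) ^ ((insert a S).card + T.card) * g T =
          -(∑ T ∈ S.powerset, (-1) ^ (S.card + T.card) * g T) +
            ∑ T ∈ S.powerset, (-1) ^ (S.card + T.card) * g (insert a T) := by
      intro S hS
      have haS : a ∉ S := fun h => ha (Finset.mem_powerset.1 hS h)
      rw [Finset.sum_powerset_insert haS, Finset.card_insert_of_notMem haS, ← Finset.sum_neg_distrib]
      congr 1
      · exact Finset.sum_congr rfl fun T _ => by ring
      · refine Finset.sum_congr rfl fun T hT => ?_
        rw [Finset.card_insert_of_notMem fun h => haS (Finset.mem_powerset.1 hT h)]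
        ring
    rw [Finset.sum_congr rfl hstep, Finset.sum_add_distrib, Finset.sum_neg_distrib, ih,
      ih (fun T => g (insert a T))]
    ring

omit [IsProbabilityMeasure ν] in
theorem sum_component (A : Finset V) (z : V → E) :
    ∑ S ∈ A.powerset, component ν S f z = avg ν A f z :=
  sum_powerset_moebius A fun T => avg ν T f z

/-- For `s ∈ S \ T`, the subsets `R` and `insert s R` meet `T` in the same set and carry opposite
signs, so they cancel in pairs. -/
theorem avg_component_of_ssubset (hf : BoundedMeasurable f) {S T : Finset V} (hTS : T ⊂ S)
    (z : V → E) : avg ν T (component ν S f) z = 0 := by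
  classical
  obtain ⟨s, hsS, hsT⟩ := Finset.exists_of_ssubset hTS
  obtain ⟨S₀, hs, rfl⟩ : ∃ S₀, s ∉ S₀ ∧ insert s S₀ = S :=
    ⟨S.erase s, Finset.notMem_erase s S, Finset.insert_erase hsS⟩
  unfold component
  rw [avg_finset_sum ν _ _ fun R => hf.avg ν R]
  simp only [avg_avg ν hf]
  rw [Finset.sum_powerset_insert hs, ← Finset.sum_add_distrib]
  refine Finset.sum_eq_zero fun R hR => ?_
  rw [Finset.inter_insert_of_notMem hsT,
    Finset.card_insert_of_notMem fun h => hs (Finset.mem_powerset.1 hR h)]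
  ring

theorem avg_component_self (hf : BoundedMeasurable f) (S : Finset V)
    (z : V → E) : avg ν S (component ν S f) z = component ν S f z := by
  classical
  unfold component
  rw [avg_finset_sum ν _ _ fun R => hf.avg ν R]
  refine Finset.sum_congr rfl fun R hR => ?_
  rw [avg_avg ν hf, Finset.inter_eq_right.2 (Finset.mem_powerset.1 hR)]

theorem component_component (hf : BoundedMeasurable f) (S : Finset V) (z : V → E) :
    component ν S (component ν S f) z = component ν S f z := by
  rw [component, Finset.sum_eq_single S]
  · rw [avg_component_self ν hf, Even.neg_one_pow ⟨_, rfl⟩, one_mul]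
  · intro T hT hne
    rw [avg_component_of_ssubset ν hf ((Finset.mem_powerset.1 hT).ssubset_of_ne hne), mul_zero]
  · exact fun h => absurd (Finset.mem_powerset_self S) h

theorem integral_component_mul_comm (hf : BoundedMeasurable f) (hg : BoundedMeasurable g)
    (S : Finset V) :
    ∫ z, component ν S f z * g z ∂(Measure.infinitePi fun _ : V => ν) =
      ∫ z, f z * component ν S g z ∂(Measure.infinitePi fun _ : V => ν) := by
  simp only [component, Finset.sum_mul, Finset.mul_sum]
  rw [integral_finsetSum _ fun T _ =>
      (((BoundedMeasurable.const _).mul (hf.avg ν T)).mul hg).integrable _,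
    integral_finsetSum _ fun T _ =>
      (hf.mul ((BoundedMeasurable.const _).mul (hg.avg ν T))).integrable _]
  refine Finset.sum_congr rfl fun T _ => ?_
  simp only [mul_assoc, mul_left_comm (f _), integral_const_mul]
  congr 1
  rw [integral_avg_mul ν hf hg]
  simp only [mul_comm (f _), mul_comm (avg ν T f _)]
  exact (integral_avg_mul ν hg hf T).symm

theorem integral_component_mul (hf : BoundedMeasurable f) (hg : BoundedMeasurable g)
    (S : Finset V) :
    ∫ z, component ν S f z * component ν S g z ∂(Measure.infinitePi fun _ : V => ν) =
      ∫ z, component ν S f z * g z ∂(Measure.infinitePi fun _ : V => ν) := by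
  rw [← integral_component_mul_comm ν (hf.component ν S) hg]
  simp only [component_component ν hf]

/-- Each component map is idempotent and self-adjoint, so one of the two projections can be dropped;
the remaining components sum to `avg ν A f`. This takes the place of a full orthogonal expansion. -/
theorem sum_integral_component_mul (hf : BoundedMeasurable f) (hg : BoundedMeasurable g)
    (A : Finset V) :
    ∑ S ∈ A.powerset,
        ∫ z, component ν S f z * component ν S g z ∂(Measure.infinitePi fun _ : V => ν) =
      ∫ z, avg ν A f z * g z ∂(Measure.infinitePi fun _ : V => ν) := by
  simp only [integral_component_mul ν hf hg]
  rw [← integral_finsetSum _ fun S _ => ((hf.component ν S).mul hg).integrable _]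
  simp only [← Finset.sum_mul, sum_component]

/-- The squared `L²` norm of a component. -/
noncomputable def energy (S : Finset V) (f : (V → E) → ℝ) : ℝ :=
  ∫ z, component ν S f z ^ 2 ∂(Measure.infinitePi fun _ : V => ν)

omit [IsProbabilityMeasure ν] in
theorem energy_nonneg (S : Finset V) : 0 ≤ energy ν S f :=
  integral_nonneg fun _ => sq_nonneg _

theorem integral_avg_mul_self_le (hf : BoundedMeasurable f) (A : Finset V) :
    ∫ z, avg ν A f z * f z ∂(Measure.infinitePi fun _ : V => ν) ≤
      ∫ z, f z ^ 2 ∂(Measure.infinitePi fun _ : V => ν) := by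
  have hA := hf.avg ν A
  have h0 : 0 ≤ ∫ z, (f z - avg ν A f z) ^ 2 ∂(Measure.infinitePi fun _ : V => ν) :=
    integral_nonneg fun _ => sq_nonneg _
  have e : ∀ z, (f z - avg ν A f z) ^ 2 =
      (f z * f z - 2 * (avg ν A f z * f z)) + avg ν A f z * avg ν A f z := fun z => by ring
  simp only [e] at h0
  rw [integral_add (((hf.mul hf).sub ((BoundedMeasurable.const 2).mul (hA.mul hf))).integrable _)
      ((hA.mul hA).integrable _),
    integral_sub ((hf.mul hf).integrable _)
      (((BoundedMeasurable.const 2).mul (hA.mul hf)).integrable _),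
    integral_const_mul, ← integral_avg_mul ν hf hf] at h0
  simp only [pow_two]
  linarith

/-- Bessel's inequality: all members of `𝒮` are subsets of their union `A`, and the energies over
subsets of `A` add up to the integral of `avg ν A f * f`. -/
theorem sum_energy_le (hf : BoundedMeasurable f) (𝒮 : Finset (Finset V)) :
    ∑ S ∈ 𝒮, energy ν S f ≤ ∫ z, f z ^ 2 ∂(Measure.infinitePi fun _ : V => ν) := by
  classical
  refine le_trans ?_ (integral_avg_mul_self_le ν hf (𝒮.biUnion id))
  rw [← sum_integral_component_mul ν hf hf]
  simp only [energy, pow_two]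
  refine Finset.sum_le_sum_of_subset_of_nonneg (fun S hS => ?_) fun S _ _ =>
    integral_nonneg fun _ => mul_self_nonneg _
  exact Finset.mem_powerset.2 (Finset.subset_biUnion_of_mem id hS)

theorem summable_energy (hf : BoundedMeasurable f) : Summable fun S => energy ν S f :=
  summable_of_sum_le (fun S => energy_nonneg ν S) (sum_energy_le ν hf)

theorem tsum_energy_le (hf : BoundedMeasurable f) :
    ∑' S, energy ν S f ≤ ∫ z, f z ^ 2 ∂(Measure.infinitePi fun _ : V => ν) :=
  (summable_energy ν hf).tsum_le_of_sum_le (sum_energy_le ν hf)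

omit [IsProbabilityMeasure ν] in
theorem component_empty (z : V → E) :
    component ν ∅ f z = ∫ z, f z ∂(Measure.infinitePi fun _ : V => ν) := by
  have h : ∀ z' : V → E, merge ∅ z z' = z' := fun z' => by
    ext v
    simp [merge]
  simp [component, avg, h]

theorem integral_mul_component_le (hf : BoundedMeasurable f) (hg : BoundedMeasurable g)
    {c : ℝ} (hc : 0 < c) (S : Finset V) :
    ∫ z, component ν S f z * component ν S g z ∂(Measure.infinitePi fun _ : V => ν) ≤
      (energy ν S f * c + energy ν S g * c⁻¹) / 2 := by
  have hF := hf.component ν S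
  have hH := hg.component ν S
  have h : ∀ z, component ν S f z * component ν S g z ≤
      c / 2 * (component ν S f z * component ν S f z) +
        c⁻¹ / 2 * (component ν S g z * component ν S g z) := by
    intro z
    have h0 := mul_nonneg (inv_nonneg.2 hc.le)
      (sq_nonneg (c * component ν S f z - component ν S g z))
    have h1 : c⁻¹ * c = 1 := inv_mul_cancel₀ hc.ne'
    have e : c⁻¹ * (c * component ν S f z - component ν S g z) ^ 2 =
        c * component ν S f z ^ 2 - 2 * (component ν S f z * component ν S g z) +
          c⁻¹ * component ν S g z ^ 2 := by
      linear_combination (c * component ν S f z ^ 2 -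
        2 * (component ν S f z * component ν S g z)) * h1
    nlinarith
  have i1 := ((BoundedMeasurable.const (c / 2)).mul (hF.mul hF)).integrable
    (Measure.infinitePi fun _ : V => ν)
  have i2 := ((BoundedMeasurable.const (c⁻¹ / 2)).mul (hH.mul hH)).integrable
    (Measure.infinitePi fun _ : V => ν)
  refine (integral_mono ((hF.mul hH).integrable _) (i1.add i2) h).trans (le_of_eq ?_)
  rw [integral_add' i1 i2, integral_const_mul, integral_const_mul]
  simp only [energy, pow_two]
  ring

/-- `f` is an `L¹` limit of functions of finitely many labels. -/
def IsApproximable (f : (V → E) → ℝ) : Prop :=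
  ∀ ε : ℝ, 0 < ε → ∃ A : Finset V,
    ∫ z, |f z - avg ν A f z| ∂(Measure.infinitePi fun _ : V => ν) ≤ ε

theorem integral_mul_le_of_weight (hf : BoundedMeasurable f) (hg : BoundedMeasurable g)
    (happ : IsApproximable ν f) (h0 : ∫ z, f z ∂(Measure.infinitePi fun _ : V => ν) = 0)
    {w : Finset V → ℝ} (hw0 : ∀ S, 0 ≤ w S) (hw : ∀ S : Finset V, S.Nonempty → 0 < w S)
    (hfs : Summable fun S => energy ν S f * w S)
    (hgs : Summable fun S => energy ν S g * (w S)⁻¹) :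
    ∫ z, f z * g z ∂(Measure.infinitePi fun _ : V => ν) ≤
      (∑' S, energy ν S f * w S + ∑' S, energy ν S g * (w S)⁻¹) / 2 := by
  have hterm : ∀ S,
      ∫ z, component ν S f z * component ν S g z ∂(Measure.infinitePi fun _ : V => ν) ≤
        (energy ν S f * w S + energy ν S g * (w S)⁻¹) / 2 := by
    intro S
    rcases S.eq_empty_or_nonempty with rfl | hS
    -- The weight of `∅` may vanish, so AM-GM is unavailable there; instead the component of `f` is
    -- its mean, which is zero.
    · simp only [component_empty, h0, zero_mul, integral_zero]
      have := mul_nonneg (energy_nonneg (f := f) ν ∅) (hw0 ∅)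
      have := mul_nonneg (energy_nonneg (f := g) ν ∅) (inv_nonneg.2 (hw0 ∅))
      linarith
    · exact integral_mul_component_le ν hf hg (hw S hS) S
  have hA : ∀ A : Finset V, ∫ z, avg ν A f z * g z ∂(Measure.infinitePi fun _ : V => ν) ≤
      (∑' S, energy ν S f * w S + ∑' S, energy ν S g * (w S)⁻¹) / 2 := by
    intro A
    rw [← sum_integral_component_mul ν hf hg]
    refine (Finset.sum_le_sum fun S _ => hterm S).trans ?_
    rw [← Finset.sum_div, Finset.sum_add_distrib]
    gcongr
    · exact hfs.sum_le_tsum _ fun S _ => mul_nonneg (energy_nonneg ν S) (hw0 S)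
    · exact hgs.sum_le_tsum _ fun S _ => mul_nonneg (energy_nonneg ν S) (inv_nonneg.2 (hw0 S))
  obtain ⟨C, hC⟩ := hg.bound
  refine le_of_forall_pos_le_add fun ε hε => ?_
  -- The bound `hA` is uniform in `A`; since `g` is bounded, `L¹` closeness of `avg ν A f` to `f`
  -- carries it over to `f`.
  obtain ⟨A, hε'⟩ := happ (ε / (|C| + 1)) (by positivity)
  have hfA := hf.sub (hf.avg ν A)
  have hdiff : ∫ z, f z * g z ∂(Measure.infinitePi fun _ : V => ν) -
      ∫ z, avg ν A f z * g z ∂(Measure.infinitePi fun _ : V => ν) ≤ ε := by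
    rw [← integral_sub ((hf.mul hg).integrable _) (((hf.avg ν A).mul hg).integrable _)]
    calc _ ≤ ∫ z, (|C| + 1) * |f z - avg ν A f z| ∂(Measure.infinitePi fun _ : V => ν) := by
          refine integral_mono (((hf.mul hg).sub ((hf.avg ν A).mul hg)).integrable _)
            (((BoundedMeasurable.const _).mul hfA.abs).integrable _) fun z => ?_
          simp only
          rw [← sub_mul, mul_comm]
          refine (le_abs_self _).trans ?_
          rw [abs_mul]
          exact mul_le_mul_of_nonneg_right
            ((hC z).trans ((le_abs_self C).trans (by linarith))) (abs_nonneg _)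
      _ ≤ ε := by
          rw [integral_const_mul]
          calc _ ≤ (|C| + 1) * (ε / (|C| + 1)) :=
                mul_le_mul_of_nonneg_left hε' (by positivity)
            _ = ε := mul_div_cancel₀ _ (by positivity)
  linarith [hA A]

/-- Averaging fixes `g` and contracts `L¹`, so up to a factor 2 it approximates as well as any
function of the labels on `A`. -/
theorem integral_abs_sub_avg_le (hf : BoundedMeasurable f) (hg : BoundedMeasurable g)
    {A : Finset V} (hA : ∀ z z', g (merge A z z') = g z) :
    ∫ z, |f z - avg ν A f z| ∂(Measure.infinitePi fun _ : V => ν) ≤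
      2 * ∫ z, |f z - g z| ∂(Measure.infinitePi fun _ : V => ν) := by
  have hfg := (hf.sub hg).abs
  have h : ∀ z, |f z - avg ν A f z| ≤ |f z - g z| + avg ν A (fun z => |f z - g z|) z := by
    intro z
    have e : g z - avg ν A f z = - avg ν A (fun z => f z - g z) z := by
      simp only [avg, hA]
      rw [integral_sub ((hf.comp_merge_right A z).integrable _)
        ((BoundedMeasurable.const _).integrable _)]
      simp
    have h1 : |g z - avg ν A f z| ≤ avg ν A (fun z => |f z - g z|) z := by
      rw [e, abs_neg]
      exact abs_integral_le_integral_abs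
    calc |f z - avg ν A f z| = |(f z - g z) + (g z - avg ν A f z)| := by ring_nf
      _ ≤ _ := (abs_add_le _ _).trans (add_le_add le_rfl h1)
  refine (integral_mono ((hf.sub (hf.avg ν A)).abs.integrable _)
    ((hfg.add (hfg.avg ν A)).integrable _) h).trans (le_of_eq ?_)
  rw [integral_add (hfg.integrable _) ((hfg.avg ν A).integrable _), integral_avg ν hfg]
  ring

theorem isApproximable_indicator_sub {B : Set (V → E)} (hB : MeasurableSet B) (c : ℝ) :
    IsApproximable ν (fun z => B.indicator (fun _ => (1 : ℝ)) z - c) := by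
  intro ε hε
  -- Cylinders are a generating ring, hence dense in measure; `ε / 2` absorbs the factor 2 above.
  obtain ⟨t, ht, hlt⟩ := exists_measure_symmDiff_lt_of_generateFrom_isSetRing
    (μ := Measure.infinitePi fun _ : V => ν)
    (isSetRing_measurableCylinders (α := fun _ : V => E))
    ⟨{Set.univ}, Set.countable_singleton _,
      Set.singleton_subset_iff.2 (univ_mem_measurableCylinders _), by simp⟩
    generateFrom_measurableCylinders.symm hB
    (ε := ENNReal.ofReal (ε / 2)) (ENNReal.ofReal_pos.2 (by linarith))
  obtain ⟨A, S, hS, rfl⟩ := (mem_measurableCylinders _).1 ht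
  have htm : MeasurableSet (cylinder (α := fun _ : V => E) A S) := hS.cylinder A
  have hf := (BoundedMeasurable.indicator hB).sub (.const c)
  have hg := (BoundedMeasurable.indicator htm).sub (.const c)
  refine ⟨A, (integral_abs_sub_avg_le ν hf hg fun z z' => ?_).trans ?_⟩
  · have : A.restrict (merge A z z') = A.restrict z := by
      ext i
      simp [merge]
    have hmem : merge A z z' ∈ cylinder (α := fun _ : V => E) A S ↔
        z ∈ cylinder (α := fun _ : V => E) A S := by
      rw [mem_cylinder, mem_cylinder, this]
    by_cases hz : z ∈ cylinder (α := fun _ : V => E) A S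
    · rw [Set.indicator_of_mem (hmem.2 hz), Set.indicator_of_mem hz]
    · rw [Set.indicator_of_notMem (mt hmem.1 hz), Set.indicator_of_notMem hz]
  · have e : ∀ z, |(B.indicator (fun _ => (1 : ℝ)) z - c) -
        ((cylinder A S).indicator (fun _ => (1 : ℝ)) z - c)| =
          (symmDiff (cylinder A S) B).indicator (fun _ => (1 : ℝ)) z := by
      intro z
      rw [sub_sub_sub_cancel_right]
      by_cases h1 : z ∈ B <;> by_cases h2 : z ∈ cylinder A S <;>
        simp [h1, h2, Set.mem_symmDiff]
    simp only [e]
    rw [integral_indicator_const _ (htm.symmDiff hB), smul_eq_mul, mul_one]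
    have : (Measure.infinitePi fun _ : V => ν).real (symmDiff (cylinder A S) B) ≤ ε / 2 :=
      ENNReal.toReal_le_of_le_ofReal (by linarith) hlt.le
    linarith

section Action

variable {G : SimpleGraph V}

omit [MeasurableSpace E] in
theorem act_merge (γ : G ≃g G) (A : Finset V) (z z' : V → E) :
    act γ (merge A z z') = merge (A.map γ.toEquiv.toEmbedding) (act γ z) (act γ z') := by
  ext v
  have : v ∈ A.map γ.toEquiv.toEmbedding ↔ γ.symm v ∈ A :=
    Finset.mem_map_equiv
  by_cases hv : γ.symm v ∈ A <;> simp only [act, merge, this, hv, if_true, if_false]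

theorem measurePreserving_act (γ : G ≃g G) :
    MeasurePreserving (act γ : (V → E) → (V → E)) (Measure.infinitePi fun _ : V => ν)
      (Measure.infinitePi fun _ : V => ν) :=
  ⟨measurable_pi_lambda _ fun _ => measurable_pi_apply _,
    Measure.map_infinitePi_infinitePi_of_inj (P := fun _ : V => ν) γ.symm.injective⟩

theorem integral_act (hf : BoundedMeasurable f) (γ : G ≃g G) :
    ∫ z, f (act γ z) ∂(Measure.infinitePi fun _ : V => ν) =
      ∫ z, f z ∂(Measure.infinitePi fun _ : V => ν) := by
  have hmp := measurePreserving_act (V := V) ν γ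
  conv_rhs => rw [← hmp.map_eq, integral_map hmp.measurable.aemeasurable
    hf.measurable.aestronglyMeasurable]

theorem avg_act (hf : BoundedMeasurable f) (γ : G ≃g G) (A : Finset V) (z : V → E) :
    avg ν (A.map γ.toEquiv.toEmbedding) f (act γ z) = avg ν A (fun z => f (act γ z)) z := by
  simp only [avg, act_merge]
  exact (integral_act ν (hf.comp_merge_right _ _) γ).symm

theorem component_act (hf : BoundedMeasurable f) (γ : G ≃g G) (S : Finset V) (z : V → E) :
    component ν (S.map γ.toEquiv.toEmbedding) f (act γ z) =
      component ν S (fun z => f (act γ z)) z := by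
  refine (Finset.sum_bij (fun T _ => T.map γ.toEquiv.toEmbedding) ?_ ?_ ?_ ?_).symm
  · intro T hT
    exact Finset.mem_powerset.2 (Finset.map_subset_map.2 (Finset.mem_powerset.1 hT))
  · intro T _ T' _ h
    exact Finset.map_injective _ h
  · intro T hT
    obtain ⟨T', hT', rfl⟩ := Finset.subset_map_iff.1 (Finset.mem_powerset.1 hT)
    exact ⟨T', Finset.mem_powerset.2 hT', rfl⟩
  · intro T _
    rw [avg_act ν hf, Finset.card_map, Finset.card_map]

theorem energy_act (hf : BoundedMeasurable f) (γ : G ≃g G) (S : Finset V) :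
    energy ν (S.map γ.toEquiv.toEmbedding) f = energy ν S (fun z => f (act γ z)) := by
  have hc := hf.component ν (S.map γ.toEquiv.toEmbedding)
  have := integral_act ν (hc.mul hc) γ
  simp only [energy, pow_two]
  rw [← this]
  simp only [component_act ν hf]

end Action

end EfronStein

/-! ### Correlation decay by averaging the weight over a sphere. -/

section CorrelationDecay

variable {V E : Type*} {G : SimpleGraph V} [G.LocallyFinite] [MeasurableSpace E] (ν : Measure E)
  [IsProbabilityMeasure ν]

omit [G.LocallyFinite] in
theorem summable_energy_mul_potentialRatio (hG : G.IsTree) {t r : ℝ} (ht : 1 ≤ t)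
    (htr : t * r = 1) {f : (V → E) → ℝ} (hf : BoundedMeasurable f) (x y : V) :
    Summable fun S => energy ν S f * potentialRatio G r x y S := by
  have hr := inv_weight_pos (by linarith) htr
  exact Summable.of_nonneg_of_le
    (fun S => mul_nonneg (energy_nonneg ν S) (potentialRatio_nonneg hr x y S))
    (fun S => mul_le_mul_of_nonneg_left (potentialRatio_le hG.connected ht htr x y S)
      (energy_nonneg ν S))
    ((summable_energy ν hf).mul_right _)

theorem tsum_energy_mul_potentialRatio_le (hG : G.IsTree) {d : ℕ} (hd : 3 ≤ d)
    (hreg : G.IsRegularOfDegree d) {t r : ℝ} (ht : 1 ≤ t) (htr : t * r = 1)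
    (htd : t ^ 2 = (d : ℝ) - 1) {f : V → (V → E) → ℝ} (hf : ∀ x, BoundedMeasurable (f x))
    (hequiv : ∀ (γ : G ≃g G) (x : V) (z : V → E), f (γ x) (act γ z) = f x z)
    {x y : V} {k : ℕ} (hxy : G.dist x y = k) :
    ∑' S, energy ν S (f x) * potentialRatio G r x y S ≤
      (k + 1) * r ^ k * ∫ z, f x z ^ 2 ∂(Measure.infinitePi fun _ : V => ν) := by
  have ht0 : 0 < t := by linarith
  have hr := inv_weight_pos ht0 htr
  set H : V → ℝ := fun y => ∑' S, energy ν S (f x) * potentialRatio G r x y S with hH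
  have hsum : ∀ y, HasSum (fun S => energy ν S (f x) * potentialRatio G r x y S) (H y) :=
    fun y => (summable_energy_mul_potentialRatio ν hG ht htr (hf x) x y).hasSum
  -- An automorphism fixing `x` and taking `y` to `y'` preserves `f x`, so reindexing the sum by `S
  -- ↦ γ S` turns `H y'` into `H y`.
  have hconst : ∀ y', G.dist x y' = k → H y' = H y := by
    intro y' hy'
    obtain ⟨γ, hγx, hγy⟩ := exists_iso_of_dist_eq hG hreg (hxy.trans hy'.symm)
    have hterm : ∀ S : Finset V,
        energy ν (S.map γ.toEquiv.toEmbedding) (f x) *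
          potentialRatio G r x y' (S.map γ.toEquiv.toEmbedding) =
        energy ν S (f x) * potentialRatio G r x y S := by
      intro S
      rw [energy_act ν (hf x), ← hγy, ← potentialRatio_map hG.connected γ r x y S, hγx]
      congr 2
      ext z
      rw [← hequiv γ x z, hγx]
    calc H y' = ∑' S, energy ν (γ.toEquiv.finsetCongr S) (f x) *
          potentialRatio G r x y' (γ.toEquiv.finsetCongr S) :=
        (γ.toEquiv.finsetCongr.tsum_eq
          (fun S => energy ν S (f x) * potentialRatio G r x y' S)).symm
      _ = H y := tsum_congr hterm
  have h1 := sphereSum_eq_of_const hG hreg hconst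
  have h2 := hasSum_sphereSum (G := G) hsum k x
  rw [h1] at h2
  simp only [sphereSum_mul_left] at h2
  have hN := sphereCard_pos hd k
  have h3 := hasSum_le (fun S => mul_le_mul_of_nonneg_left
      (sphereSum_potentialRatio_le hG hd hreg ht0 htr htd k x S) (energy_nonneg ν S)) h2
    ((summable_energy ν (hf x)).hasSum.mul_right _)
  have h4 := tsum_energy_le ν (hf x)
  have h5 : H y ≤ (k + 1) * r ^ k * ∑' S, energy ν S (f x) := by
    refine le_of_mul_le_mul_left (h3.trans (le_of_eq ?_)) hN
    ring
  exact h5.trans (mul_le_mul_of_nonneg_left h4 (by positivity))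

/-- Correlation decay for equivariant families of functions of i.i.d. labels on a regular tree. -/
theorem integral_mul_le_of_equivariant (hG : G.IsTree) {d : ℕ} (hd : 3 ≤ d)
    (hreg : G.IsRegularOfDegree d) {t r : ℝ} (ht : 1 ≤ t) (htr : t * r = 1)
    (htd : t ^ 2 = (d : ℝ) - 1) {f g : V → (V → E) → ℝ} (hf : ∀ x, BoundedMeasurable (f x))
    (hg : ∀ x, BoundedMeasurable (g x))
    (hfe : ∀ (γ : G ≃g G) (x : V) (z : V → E), f (γ x) (act γ z) = f x z)
    (hge : ∀ (γ : G ≃g G) (x : V) (z : V → E), g (γ x) (act γ z) = g x z)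
    {u v : V} {k : ℕ} (huv : G.dist u v = k) (happ : IsApproximable ν (f u))
    (h0 : ∫ z, f u z ∂(Measure.infinitePi fun _ : V => ν) = 0) :
    ∫ z, f u z * g v z ∂(Measure.infinitePi fun _ : V => ν) ≤
      (k + 1) * r ^ k / 2 * (∫ z, f u z ^ 2 ∂(Measure.infinitePi fun _ : V => ν) +
        ∫ z, g v z ^ 2 ∂(Measure.infinitePi fun _ : V => ν)) := by
  have hr := inv_weight_pos (by linarith) htr
  have hle := integral_mul_le_of_weight ν (hf u) (hg v) happ h0
    (w := potentialRatio G r u v) (potentialRatio_nonneg hr u v)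
    (fun S hS => potentialRatio_pos hr u v hS)
    (summable_energy_mul_potentialRatio ν hG ht htr (hf u) u v)
    (by
      simp only [potentialRatio_inv]
      exact summable_energy_mul_potentialRatio ν hG ht htr (hg v) v u)
  simp only [potentialRatio_inv] at hle
  have h1 := tsum_energy_mul_potentialRatio_le ν hG hd hreg ht htr htd hf hfe huv
  have h2 := tsum_energy_mul_potentialRatio_le ν hG hd hreg ht htr htd hg hge
    ((G.dist_comm).trans huv)
  linarith

end CorrelationDecay

/-! ### Comparison of mutual information with χ². -/

section ChiSquare

variable {M : Type*} [Fintype M]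

/-- Mutual information is at most the `χ²`-divergence from the product of the marginals. -/
theorem negMulLog_sum_le_chiSquare {a b : M → ℝ} {p : M → M → ℝ} (hp : ∀ i j, 0 ≤ p i j)
    (ha : ∀ i, ∑ j, p i j = a i) (hb : ∀ j, ∑ i, p i j = b j) (h1 : ∑ j, b j = 1) :
    ∑ i, Real.negMulLog (a i) + ∑ j, Real.negMulLog (b j) -
        ∑ q : M × M, Real.negMulLog (p q.1 q.2) ≤
      ∑ i, ∑ j, (p i j - a i * b j) ^ 2 / (a i * b j) := by
  have hpa : ∀ i j, p i j ≤ a i := fun i j => by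
    rw [← ha i]
    exact Finset.single_le_sum (f := p i) (fun j _ => hp i j) (Finset.mem_univ j)
  have hpb : ∀ i j, p i j ≤ b j := fun i j => by
    rw [← hb j]
    exact Finset.single_le_sum (f := fun i => p i j) (fun i _ => hp i j) (Finset.mem_univ i)
  -- This is `log x ≤ x - 1` at `x = p / (a b)`, multiplied by `p`. The linear term `p - a b` sums
  -- to zero.
  have hterm : ∀ i j, p i j * Real.log (p i j) - p i j * Real.log (a i) -
      p i j * Real.log (b j) ≤
        (p i j - a i * b j) ^ 2 / (a i * b j) + (p i j - a i * b j) := by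
    intro i j
    rcases (hp i j).eq_or_lt with h | h
    · rw [← h]
      simp only [zero_mul, sub_zero, zero_sub, neg_sq]
      rw [pow_two, mul_self_div_self]
      linarith
    · have hai := h.trans_le (hpa i j)
      have hbj := h.trans_le (hpb i j)
      have hlog := Real.log_le_sub_one_of_pos (div_pos h (mul_pos hai hbj))
      rw [Real.log_div h.ne' (mul_pos hai hbj).ne', Real.log_mul hai.ne' hbj.ne'] at hlog
      have hmul := mul_le_mul_of_nonneg_left hlog h.le
      have e : (p i j - a i * b j) ^ 2 / (a i * b j) + (p i j - a i * b j) =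
          p i j * (p i j / (a i * b j) - 1) := by
        field_simp
        ring
      rw [e]
      linarith
  have hsum := Finset.sum_le_sum fun i (_ : i ∈ Finset.univ) =>
    Finset.sum_le_sum fun j (_ : j ∈ Finset.univ) => hterm i j
  simp only [Finset.sum_add_distrib, Finset.sum_sub_distrib, ← Finset.sum_mul, ha,
    ← Finset.mul_sum, h1, mul_one, sub_self, add_zero] at hsum
  have e2 : ∑ i, ∑ j, p i j * Real.log (b j) = ∑ j, b j * Real.log (b j) := by
    rw [Finset.sum_comm]
    simp only [← Finset.sum_mul, hb]
  rw [e2] at hsum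
  simp only [Real.negMulLog, neg_mul, Finset.sum_neg_distrib, Fintype.sum_prod_type]
  linarith

end ChiSquare

/-! ### Application to factor of i.i.d. processes. -/

section Factor

variable {V E M : Type*} [MeasurableSpace E] [MeasurableSpace M] [DiscreteMeasurableSpace M]
  {G : SimpleGraph V} {F : (V → E) → (V → M)}

/-- The indicator function of the event that the process `F` takes the value `i` at `v`. -/
noncomputable def valueIndicator (F : (V → E) → (V → M)) (i : M) (v : V) : (V → E) → ℝ :=
  {z | F z v = i}.indicator fun _ => 1

theorem IsFactor.measurableSet_value (hF : IsFactor G F) (i : M) (v : V) :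
    MeasurableSet {z | F z v = i} :=
  (measurable_pi_apply v).comp hF.measurable (MeasurableSet.of_discrete (s := {i}))

theorem IsFactor.boundedMeasurable_valueIndicator (hF : IsFactor G F) (i : M) (v : V) :
    BoundedMeasurable (valueIndicator F i v) :=
  .indicator (hF.measurableSet_value i v)

omit [DiscreteMeasurableSpace M] in
theorem IsFactor.apply_iso (hF : IsFactor G F) (γ : G ≃g G) (x : V) (z : V → E) :
    F (act γ z) (γ x) = F z x := by
  rw [hF.equivariant]
  simp [act]

omit [DiscreteMeasurableSpace M] in
theorem IsFactor.valueIndicator_iso (hF : IsFactor G F) (i : M) (γ : G ≃g G) (x : V)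
    (z : V → E) : valueIndicator F i (γ x) (act γ z) = valueIndicator F i x z := by
  by_cases h : F z x = i <;> simp [valueIndicator, hF.apply_iso, h]

omit [MeasurableSpace E] [MeasurableSpace M] [DiscreteMeasurableSpace M] in
theorem valueIndicator_mul_self (i : M) (v : V) (z : V → E) :
    valueIndicator F i v z * valueIndicator F i v z = valueIndicator F i v z := by
  by_cases h : F z v = i <;> simp [valueIndicator, h]

omit [MeasurableSpace E] [MeasurableSpace M] [DiscreteMeasurableSpace M] in
theorem sum_mul_valueIndicator [Fintype M] (ψ : M → ℝ) (v : V) (z : V → E) :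
    ∑ j, ψ j * valueIndicator F j v z = ψ (F z v) := by
  classical
  simp [valueIndicator, Set.indicator]

variable [Fintype M] [G.LocallyFinite] (ν : Measure E) [IsProbabilityMeasure ν]

theorem IsFactor.chiSquare_row_le (hG : G.IsTree) {d : ℕ} (hd : 3 ≤ d)
    (hreg : G.IsRegularOfDegree d) {t r : ℝ} (ht : 1 ≤ t) (htr : t * r = 1)
    (htd : t ^ 2 = (d : ℝ) - 1) (hF : IsFactor G F) {u v : V} {k : ℕ} (huv : G.dist u v = k)
    {a : ℝ} {b p : M → ℝ} (i : M)
    (ha : ∫ z, valueIndicator F i u z ∂(Measure.infinitePi fun _ : V => ν) = a)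
    (hb : ∀ j, ∫ z, valueIndicator F j v z ∂(Measure.infinitePi fun _ : V => ν) = b j)
    (hp : ∀ j, ∫ z, valueIndicator F i u z * valueIndicator F j v z
      ∂(Measure.infinitePi fun _ : V => ν) = p j) :
    ∑ j, (p j - a * b j) ^ 2 / b j ≤ ((k + 1) * r ^ k) ^ 2 * a := by
  have hr := inv_weight_pos (by linarith) htr
  have hI := fun j x => hF.boundedMeasurable_valueIndicator j x
  set ρ : ℝ := (k + 1) * r ^ k with hρ
  have hρ0 : 0 < ρ := by positivity
  set s : ℝ := ∑ j, (p j - a * b j) ^ 2 / b j with hs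
  -- The test function extremal for χ². With the scale `ρ⁻¹` the correlation bound reads `2 s ≤ ρ²
  -- (a - a²) + s`, so the `g` term can be absorbed. If `b j = 0`, the quotient is `0`.
  set ψ : M → ℝ := fun j => ρ⁻¹ * ((p j - a * b j) / b j) with hψ
  set f : V → (V → E) → ℝ := fun x z => valueIndicator F i x z - a with hf
  set g : V → (V → E) → ℝ := fun x z => ∑ j, ψ j * valueIndicator F j x z with hg
  have hfb : ∀ x, BoundedMeasurable (f x) := fun x => (hI i x).sub (.const a)
  have hgb : ∀ x, BoundedMeasurable (g x) := fun x =>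
    .finset_sum _ fun j => (BoundedMeasurable.const (ψ j)).mul (hI j x)
  have key := integral_mul_le_of_equivariant ν hG hd hreg ht htr htd hfb hgb
    (fun γ x z => by simp only [hf, hF.valueIndicator_iso])
    (fun γ x z => by simp only [hg, hF.valueIndicator_iso])
    huv (isApproximable_indicator_sub ν (hF.measurableSet_value i u) a)
    (by
      simp only [hf]
      rw [integral_sub ((hI i u).integrable _) ((BoundedMeasurable.const a).integrable _), ha]
      simp)
  have hff : ∫ z, f u z ^ 2 ∂(Measure.infinitePi fun _ : V => ν) = a - a ^ 2 := by
    have e : ∀ z, f u z ^ 2 = (1 - 2 * a) * valueIndicator F i u z + a ^ 2 := fun z => by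
      have := valueIndicator_mul_self (F := F) i u z
      simp only [hf]
      linear_combination this
    simp only [e]
    rw [integral_add (((BoundedMeasurable.const _).mul (hI i u)).integrable _)
      ((BoundedMeasurable.const _).integrable _), integral_const_mul, ha]
    simp only [integral_const, probReal_univ, one_smul]
    ring
  have hgg : ∫ z, g v z ^ 2 ∂(Measure.infinitePi fun _ : V => ν) = (ρ⁻¹) ^ 2 * s := by
    -- Exactly one of the indicators is nonzero, so squaring acts on the coefficients.
    have e : ∀ z, g v z ^ 2 = ∑ j, ψ j ^ 2 * valueIndicator F j v z := fun z => by
      simp only [hg]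
      rw [sum_mul_valueIndicator, sum_mul_valueIndicator (fun j => ψ j ^ 2)]
    simp only [e]
    rw [integral_finsetSum _ fun j _ =>
      ((BoundedMeasurable.const _).mul (hI j v)).integrable _, hs, Finset.mul_sum]
    refine Finset.sum_congr rfl fun j _ => ?_
    rw [integral_const_mul, hb, hψ]
    by_cases h : b j = 0
    · simp [h]
    · field_simp
  have hfg : ∫ z, f u z * g v z ∂(Measure.infinitePi fun _ : V => ν) = ρ⁻¹ * s := by
    have e : ∀ z, f u z * g v z = ∑ j, ψ j *
        (valueIndicator F i u z * valueIndicator F j v z - a * valueIndicator F j v z) :=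
      fun z => by
        simp only [hg]
        rw [Finset.mul_sum]
        exact Finset.sum_congr rfl fun j _ => by simp only [hf]; ring
    simp only [e]
    rw [integral_finsetSum _ fun j _ => ((BoundedMeasurable.const _).mul
        (((hI i u).mul (hI j v)).sub ((BoundedMeasurable.const a).mul (hI j v)))).integrable _,
      hs, Finset.mul_sum]
    refine Finset.sum_congr rfl fun j _ => ?_
    rw [integral_const_mul, integral_sub (((hI i u).mul (hI j v)).integrable _)
      (((BoundedMeasurable.const a).mul (hI j v)).integrable _), integral_const_mul, hp, hb, hψ]
    ring
  rw [hff, hgg, hfg] at key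
  have h1 : ρ⁻¹ * ρ = 1 := inv_mul_cancel₀ hρ0.ne'
  have h2 := mul_le_mul_of_nonneg_left key (by positivity : 0 ≤ 2 * ρ)
  have h3 : 2 * ρ * (ρ⁻¹ * s) = 2 * s := by linear_combination 2 * s * h1
  have h4 : 2 * ρ * (ρ / 2 * (a - a ^ 2 + ρ⁻¹ ^ 2 * s)) = ρ ^ 2 * a - ρ ^ 2 * a ^ 2 + s := by
    linear_combination (s * (ρ⁻¹ * ρ + 1)) * h1
  rw [h3, h4] at h2
  nlinarith [mul_nonneg (sq_nonneg ρ) (sq_nonneg a)]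

theorem IsIIDUniform.measurePreserving {Ω : Type*} [MeasurableSpace Ω] {P : Measure Ω}
    [IsProbabilityMeasure P] {Z : V → Ω → unitInterval} (hZ : IsIIDUniform P Z) :
    MeasurePreserving (fun ω v => Z v ω) P
      (Measure.infinitePi fun _ : V => (volume : Measure unitInterval)) := by
  refine ⟨measurable_pi_lambda _ hZ.measurable, ?_⟩
  rw [hZ.indep.map_fun_eq_infinitePi_map hZ.measurable]
  simp only [hZ.law]

/-- The mutual information of a factor of i.i.d. process at two vertices of a regular tree decays
exponentially in their distance. -/
theorem IsFactorOfIID.mutualInfo_le {Ω : Type*} (hG : G.IsTree) {d : ℕ} (hd : 3 ≤ d)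
    (hreg : G.IsRegularOfDegree d) [MeasurableSpace Ω] {P : Measure Ω} [IsProbabilityMeasure P]
    {X : V → Ω → M} (hX : IsFactorOfIID G P X) {k : ℕ} {u v : V} (huv : G.dist u v = k) :
    mutualInfo P (X u) (X v) ≤
      (Fintype.card M : ℝ) * ((k : ℝ) + 1) ^ 2 / ((d : ℝ) - 1) ^ k := by
  obtain ⟨Z, F, hZ, hF, hXF⟩ := hX
  have hd' : (3 : ℝ) ≤ d := by exact_mod_cast hd
  set μ : Measure (V → unitInterval) :=
    Measure.infinitePi fun _ : V => (volume : Measure unitInterval) with hμ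
  have hmp := hZ.measurePreserving
  have hI := fun j x => hF.boundedMeasurable_valueIndicator j x
  set a : V → M → ℝ := fun x i => ∫ z, valueIndicator F i x z ∂μ with ha
  set p : M → M → ℝ := fun i j => ∫ z, valueIndicator F i u z * valueIndicator F j v z ∂μ with hp
  have hmarg : ∀ x i, P.real (X x ⁻¹' {i}) = a x i := by
    intro x i
    have e : X x ⁻¹' {i} = (fun ω v => Z v ω) ⁻¹' {z | F z x = i} := by
      ext ω
      simp [hXF]
    rw [e, Measure.real, hmp.measure_preimage (hF.measurableSet_value i x).nullMeasurableSet, ha]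
    simp only [valueIndicator]
    rw [integral_indicator_const _ (hF.measurableSet_value i x), smul_eq_mul, mul_one]
    rfl
  have hjoint : ∀ q : M × M, P.real ((fun ω => (X u ω, X v ω)) ⁻¹' {q}) = p q.1 q.2 := by
    rintro ⟨i, j⟩
    have hms := (hF.measurableSet_value i u).inter (hF.measurableSet_value j v)
    have e : (fun ω => (X u ω, X v ω)) ⁻¹' {(i, j)} =
        (fun ω v => Z v ω) ⁻¹' ({z | F z u = i} ∩ {z | F z v = j}) := by
      ext ω
      simp [hXF]
    rw [e, Measure.real, hmp.measure_preimage hms.nullMeasurableSet, hp]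
    have e2 : ∀ z, valueIndicator F i u z * valueIndicator F j v z =
        ({z | F z u = i} ∩ {z | F z v = j}).indicator (fun _ => (1 : ℝ)) z := fun z => by
      by_cases h1 : F z u = i <;> by_cases h2 : F z v = j <;> simp [valueIndicator, h1, h2]
    simp only [e2]
    rw [integral_indicator_const _ hms, smul_eq_mul, mul_one]
    rfl
  have hsum1 : ∀ x z, ∑ j, valueIndicator F j x z = 1 := fun x z => by
    simpa using sum_mul_valueIndicator (F := F) (fun _ => 1) x z
  have htot : ∀ x, ∑ i, a x i = 1 := fun x => by
    simp only [ha]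
    rw [← integral_finsetSum _ fun i _ => (hI i x).integrable _]
    simp [hsum1]
  have hrow : ∀ i, ∑ j, p i j = a u i := fun i => by
    simp only [hp, ha]
    rw [← integral_finsetSum _ fun j _ => ((hI i u).mul (hI j v)).integrable _]
    simp only [← Finset.mul_sum, hsum1, mul_one]
  have hcol : ∀ j, ∑ i, p i j = a v j := fun j => by
    simp only [hp, ha]
    rw [← integral_finsetSum _ fun i _ => ((hI i u).mul (hI j v)).integrable _]
    simp only [← Finset.sum_mul, hsum1, one_mul]
  have hnn : ∀ x i z, 0 ≤ valueIndicator F i x z := fun x i z =>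
    Set.indicator_nonneg (fun _ _ => zero_le_one) z
  have hchi := negMulLog_sum_le_chiSquare
    (fun i j => integral_nonneg fun z => mul_nonneg (hnn u i z) (hnn v j z)) hrow hcol
    (htot v)
  have ht1 : 1 ≤ √((d : ℝ) - 1) := Real.one_le_sqrt.2 (by linarith)
  have htd : √((d : ℝ) - 1) ^ 2 = (d : ℝ) - 1 := Real.sq_sqrt (by linarith)
  have hmain : ∀ i, ∑ j, (p i j - a u i * a v j) ^ 2 / (a u i * a v j) ≤
      ((k : ℝ) + 1) ^ 2 / ((d : ℝ) - 1) ^ k := by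
    intro i
    have h := hF.chiSquare_row_le volume hG hd hreg ht1
      (mul_inv_cancel₀ (by positivity)) htd huv i rfl (fun _ => rfl) (fun _ => rfl)
    have e : (((k : ℝ) + 1) * (√((d : ℝ) - 1))⁻¹ ^ k) ^ 2 =
        ((k : ℝ) + 1) ^ 2 / ((d : ℝ) - 1) ^ k := by
      rw [mul_pow, ← pow_mul, mul_comm k 2, pow_mul, inv_pow, htd, inv_pow, div_eq_mul_inv]
    rw [e] at h
    have e2 : ∑ j, (p i j - a u i * a v j) ^ 2 / (a u i * a v j) =
        (∑ j, (p i j - a u i * a v j) ^ 2 / a v j) / a u i := by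
      rw [Finset.sum_div]
      exact Finset.sum_congr rfl fun j _ => by rw [div_div, mul_comm (a u i)]
    rw [e2]
    have : (0 : ℝ) < ((d : ℝ) - 1) ^ k := pow_pos (by linarith) k
    -- Covers values `i` of probability zero as well: the row is then `0` by the convention for
    -- division.
    exact div_le_of_le_mul₀ (integral_nonneg (hnn u i)) (by positivity) h
  simp only [mutualInfo, entropy, hmarg, hjoint]
  refine hchi.trans ((Finset.sum_le_sum fun i _ => hmain i).trans (le_of_eq ?_))
  rw [Finset.sum_const, Finset.card_univ, nsmul_eq_mul, mul_div_assoc]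

end Factor

end TreeFactor

theorem theorem2 {V Ω M : Type*}
    (d : ℕ) (hd : 3 ≤ d)
    (G : SimpleGraph V) [G.LocallyFinite] (hG : G.IsTree) (hreg : G.IsRegularOfDegree d)
    [MeasurableSpace Ω] (P : Measure Ω) [IsProbabilityMeasure P]
    [Fintype M] [MeasurableSpace M] [DiscreteMeasurableSpace M]
    (X : V → Ω → M) (hX : TreeFactor.IsFactorOfIID G P X)
    (k : ℕ) (u v : V) (huv : G.dist u v = k) :
    TreeFactor.mutualInfo P (X u) (X v) ≤
      (Fintype.card M : ℝ) * ((k : ℝ) + 1) ^ 2 / ((d : ℝ) - 1) ^ k := 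
  hX.mutualInfo_le hG hd hreg huv
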